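/- \textbf{Definitions.} A clause of size $k$ on $n$ Boolean variables is a set of $k$ literals on $k$ distinct variables, and a $k$-CNF with $m$ clauses is a sequence of $m$ such clauses. It is a $(k,d)$-formula if every variable appears in at most $d$ clauses. The random $k$-CNF $\Phi_k(m,n)$ consists of $m$ independent uniformly random clauses of size $k$ on $n$ variables. Let $\Omega_\Phi\subseteq\{0,1\}^n$ be the set of satisfying assignments of $\Phi$. For real $D$, two assignments $\sigma,\sigma'\in\Omega_\Phi$ are $D$-connected if there is a sequence $\sigma=\zeta_0,\zeta_1,\dots,\zeta_\ell=\sigma'$ in $\Omega_\Phi$ in which consecutive assignments have Hamming distance at most $D$. A $D$-connected component is a class of this equivalence relation on $\Omega_\Phi$. Say that bounded-degree connectivity holds for $\gamma$ if there are constants $c'>0$, $C'>0$ and $k_0'$ such that for every $k\ge k_0'$ and every $\varepsilon>0$ there is $N'$ such that for all $n\ge N'$, all integers $d$ with $1\le d\le \frac{c'}{k^3}2^{\gamma k}$ and every $(k,d)$-formula $\Phi$ on $n$ variables, $\Omega_\Phi\neq\emptyset$ and two independent uniformly random elements of $\Omega_\Phi$ are $C'dk^2\log n$-connected with probability at least $1-\varepsilon$.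 \textbf{Theorem (Connectivity: random).} Let $\gamma>0$ be such that bounded-degree connectivity holds for $\gamma$, and let $\zeta\in(0,1)$. Then there are constants $c>0$, $C>0$ and $k_0$ (depending only on $\gamma$ and $\zeta$) such that for every $k\ge k_0$ and every $\varepsilon>0$ there is $N$ such that the following holds for all $n\ge N$ and all $m$ for which $\alpha=m/n$ satisfies $$\alpha\le \frac{c}{k^3}\,2^{(1-\zeta)\gamma k}\qquad\text{and}\qquad \alpha k^6\log n\ge 1 .$$ Put $D=C\alpha k^6\log n$. With probability at least $1-\varepsilon$ over $\Phi\sim\Phi_k(m,n)$, the set $\Omega_\Phi$ is nonempty, two independent uniformly random elements $\sigma,\sigma'$ of $\Omega_\Phi$ are $D$-connected with probability at least $1-\varepsilon$, and some $D$-connected component of $\Omega_\Phi$ contains at least $(1-\varepsilon)|\Omega_\Phi|$ elements. -/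

import Mathlib

open scoped Classical in
/-- The probability that `P` holds for a uniformly random element of the finite set `s`
(it is `0` if `s` is empty, where no uniform distribution exists). -/
noncomputable def uniformProb {α : Type*} (s : Finset α) (P : α → Prop) : ℝ :=
  ((s.filter P).card : ℝ) / (s.card : ℝ)

/-- Truth assignments to the variables `x_0, …, x_{n-1}`. -/
abbrev Assignment (n : ℕ) : Type := Fin n → Bool

/-- A literal `(v, b)` on `n` variables is satisfied by `σ` iff `σ v = b`:
`(v, true)` is the variable `v` and `(v, false)` is its negation. -/
abbrev Literal (n : ℕ) : Type := Fin n × Bool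

/-- The space of clauses of size `k` on `n` variables: sets of `k` literals on `k` distinct
variables. -/
abbrev KClause (k n : ℕ) : Type :=
  {C : Finset (Literal n) // C.card = k ∧ ∀ l ∈ C, ∀ l' ∈ C, l.1 = l'.1 → l = l'}

/-- A `k`-CNF formula with `n` variables and a sequence of `m` clauses (repetitions allowed).
A uniformly random element of this finite type is the random formula `Φ_k(m, n)`, that is,
`m` independent uniformly random clauses of size `k`. -/
abbrev KCNF (k n m : ℕ) : Type := Fin m → KClause k n

noncomputable instance instFintypeKCNF (k n m : ℕ) : Fintype (KCNF k n m) :=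
  Fintype.ofFinite _

namespace KCNF

variable {k n m : ℕ}

/-- `σ` satisfies `Φ`: every clause contains a literal satisfied by `σ`. -/
def Satisfies (Φ : KCNF k n m) (σ : Assignment n) : Prop :=
  ∀ j : Fin m, ∃ l ∈ (Φ j).1, σ l.1 = l.2

open scoped Classical in
/-- The set `Ω_Φ` of satisfying assignments. -/
noncomputable def solutions (Φ : KCNF k n m) : Finset (Assignment n) :=
  Finset.univ.filter fun σ => Φ.Satisfies σ

open scoped Classical in
/-- The number of clauses of `Φ` in which the variable `v` appears. -/
noncomputable def varDegree (Φ : KCNF k n m) (v : Fin n) : ℕ :=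
  (Finset.univ.filter fun j : Fin m => ∃ l ∈ (Φ j).1, l.1 = v).card

/-- `Φ` is a `(k, d)`-formula: each variable appears in at most `d` clauses. -/
def IsBoundedDegree (Φ : KCNF k n m) (d : ℕ) : Prop :=
  ∀ v : Fin n, Φ.varDegree v ≤ d

/-- `ζ_0 ↔ ζ_1 ↔ ⋯ ↔ ζ_ℓ` is a `D`-path: a sequence of satisfying assignments of `Φ` in which
consecutive ones have Hamming distance at most `D`. -/
def IsDPath (Φ : KCNF k n m) (D : ℝ) (ℓ : ℕ) (ζ : Fin (ℓ + 1) → Assignment n) : Prop :=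
  (∀ i, Φ.Satisfies (ζ i)) ∧
    ∀ i : Fin ℓ, (hammingDist (ζ i.castSucc) (ζ i.succ) : ℝ) ≤ D

/-- `σ` and `σ'` are `D`-connected: some `D`-path runs from `σ` to `σ'`. -/
def DConnected (Φ : KCNF k n m) (D : ℝ) (σ σ' : Assignment n) : Prop :=
  ∃ (ℓ : ℕ) (ζ : Fin (ℓ + 1) → Assignment n),
    Φ.IsDPath D ℓ ζ ∧ ζ 0 = σ ∧ ζ (Fin.last ℓ) = σ'

/-- `Φ` is satisfiable, and two independent uniformly random satisfying assignments are
`D`-connected with probability at least `1 - ε`. -/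
def RandomPairConnected (Φ : KCNF k n m) (D ε : ℝ) : Prop :=
  Φ.solutions.Nonempty ∧
    1 - ε ≤ uniformProb (Φ.solutions ×ˢ Φ.solutions) fun p => Φ.DConnected D p.1 p.2

/-- `S` is a `D`-connected component of the solution space: a nonempty set of solutions which are
pairwise `D`-connected, and which contains every solution `D`-connected to one of its members. -/
def IsDComponent (Φ : KCNF k n m) (D : ℝ) (S : Finset (Assignment n)) : Prop :=
  S.Nonempty ∧ S ⊆ Φ.solutions ∧
    (∀ σ ∈ S, ∀ τ ∈ S, Φ.DConnected D σ τ) ∧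
    ∀ σ ∈ S, ∀ τ ∈ Φ.solutions, Φ.DConnected D σ τ → τ ∈ S

/-- Some `D`-connected component contains at least a fraction `1 - ε` of all solutions. -/
def HasGiantComponent (Φ : KCNF k n m) (D ε : ℝ) : Prop :=
  ∃ S : Finset (Assignment n), Φ.IsDComponent D S ∧
    (1 - ε) * (Φ.solutions.card : ℝ) ≤ (S.card : ℝ)

end KCNF

/-- The exponent `γ` is one for which bounded-degree connectivity holds: for some `c' > 0` and for
all sufficiently large `k`, two uniformly random solutions of any `(k, d)`-formula on `n` variables
with `1 ≤ d ≤ (c' / k ^ 3) * 2 ^ (γ k)` are `O(d k ^ 2 log n)`-connected with probability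
`1 - o(1)` as `n → ∞` (with `k` fixed; the constant in `O` does not depend on `k`, `d`, `n` or the
formula). -/
def BoundedDegreeConnectivity (γ : ℝ) : Prop :=
  ∃ c' : ℝ, 0 < c' ∧ ∃ C : ℝ, 0 < C ∧ ∃ k₀ : ℕ, ∀ k : ℕ, k₀ ≤ k →
    ∀ ε : ℝ, 0 < ε → ∃ N : ℕ, ∀ n : ℕ, N ≤ n →
      ∀ d : ℕ, 1 ≤ d → (d : ℝ) ≤ c' / (k : ℝ) ^ 3 * (2 : ℝ) ^ (γ * (k : ℝ)) →
        ∀ (m : ℕ) (Φ : KCNF k n m), Φ.IsBoundedDegree d →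
          Φ.RandomPairConnected (C * ((d : ℝ) * (k : ℝ) ^ 2 * Real.log (n : ℝ))) ε

/-! The hypothesis covers formulas of bounded degree, whereas a random formula also has a few
variables of much larger degree. The remedy is to fix the values on a small set `B` containing those
variables, apply the hypothesis in each fibre, and pass between fibres by changing `B` one variable
at a time.

Dense case, `α k ^ 3 > 1`. Take `d` of order `α k ^ 4`. With high probability every nonempty set `S`
of at most `b = ⌊n / 4 ^ k⌋` clauses spans more than `(k - 3) |S|` variables, fewer than `b`
variables have degree at least `d`, and every degree is below `t = ⌈log n⌉`. By `exists_closure`,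
absorbing clauses greedily produces `B` such that each clause has at most three variables in `B` or
lies over `B`; the clauses over `B` are peelable, so their solutions are joined by single flips
(`Peelable.linked`).

Given values `τ` on `B` that satisfy the clauses over `B`, the remaining clauses keep at least `k -
3` literals. Padding them with all sign patterns on fresh variables restores size `k`, keeps the
solutions on the old variables, and gives degree at most `8 d`. The hypothesis is used with the
fixed error `1 / 2`, but on `M = n ^ 2` disjoint copies: solutions of the union are linked only if
they are linked in every copy, so an `M`-th root turns the error into `1 / M`
(`exists_large_linked_class`).

By the local lemma, the fibres over two such `τ`, `τ'` differing in one variable share at least a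
fraction `2 ^ (-t)` of their solutions. This exceeds `2 / M`, so their large classes meet at a
common `ρ`, where replacing `τ` by `τ'` is a single flip. Hence the large classes of all fibres lie
in one class, which has all but a fraction `1 / M` of the solutions (`exists_giant_linked_class`).

Sparse case, `α k ^ 3 ≤ 1`. With high probability all sets of clauses expand, so the whole formula
is peelable. -/

/-! ### Clause families over arbitrary variable sets, and linkedness. -/

section GenericFormula

variable {V J : Type*}

/-- `σ` satisfies every clause of the family `F`. -/
def FamilySat (F : J → Finset (V × Bool)) (σ : V → Bool) : Prop :=
  ∀ j, ∃ l ∈ F j, σ l.1 = l.2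

/-- `C` consists of `k` literals on `k` distinct variables. -/
def IsKClause (k : ℕ) (C : Finset (V × Bool)) : Prop :=
  C.card = k ∧ ∀ l ∈ C, ∀ l' ∈ C, l.1 = l'.1 → l = l'

/-- A move of length at most `D` between two assignments satisfying `F`. -/
def SolStep [Fintype V] (F : J → Finset (V × Bool)) (D : ℝ) (σ τ : V → Bool) : Prop :=
  FamilySat F σ ∧ FamilySat F τ ∧ (hammingDist σ τ : ℝ) ≤ D

/-- `σ` and `τ` are joined by a sequence of moves of length at most `D` between assignments
satisfying `F`. -/
def Linked [Fintype V] (F : J → Finset (V × Bool)) (D : ℝ) : (V → Bool) → (V → Bool) → Prop :=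
  Relation.ReflTransGen (SolStep F D)

theorem SolStep.symm [Fintype V] {F : J → Finset (V × Bool)} {D : ℝ} {σ τ : V → Bool}
    (h : SolStep F D σ τ) : SolStep F D τ σ :=
  ⟨h.2.1, h.1, by rw [hammingDist_comm]; exact h.2.2⟩

theorem Linked.symm [Fintype V] {F : J → Finset (V × Bool)} {D : ℝ} {σ τ : V → Bool}
    (h : Linked F D σ τ) : Linked F D τ σ := by
  induction h with
  | refl => exact Relation.ReflTransGen.refl
  | tail _ h ih => exact Relation.ReflTransGen.head h.symm ih

theorem Linked.trans [Fintype V] {F : J → Finset (V × Bool)} {D : ℝ} {σ τ υ : V → Bool}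
    (h : Linked F D σ τ) (h' : Linked F D τ υ) : Linked F D σ υ :=
  Relation.ReflTransGen.trans h h'

theorem Linked.mono [Fintype V] {F : J → Finset (V × Bool)} {D D' : ℝ} (hD : D ≤ D')
    {σ τ : V → Bool} (h : Linked F D σ τ) : Linked F D' σ τ := by
  induction h with
  | refl => exact Relation.ReflTransGen.refl
  | tail _ h ih => exact ih.tail ⟨h.1, h.2.1, h.2.2.trans hD⟩

/-- A map that preserves solutions and does not increase distances preserves linkedness. -/
theorem Linked.map [Fintype V] {V' J' : Type*} [Fintype V'] {F : J → Finset (V × Bool)}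
    {F' : J' → Finset (V' × Bool)} {D : ℝ} (f : (V → Bool) → (V' → Bool))
    (hsat : ∀ σ, FamilySat F σ → FamilySat F' (f σ))
    (hdist : ∀ σ τ, hammingDist (f σ) (f τ) ≤ hammingDist σ τ)
    {σ τ : V → Bool} (h : Linked F D σ τ) : Linked F' D (f σ) (f τ) := by
  induction h with
  | refl => exact Relation.ReflTransGen.refl
  | tail _ h ih =>
    exact ih.tail ⟨hsat _ h.1, hsat _ h.2.1, (Nat.cast_le.2 (hdist _ _)).trans h.2.2⟩

/-- Restricting assignments along an injection of variables does not increase distances. -/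
theorem hammingDist_comp_le [Fintype V] {V' : Type*} [Fintype V'] (e : V' → V)
    (he : Function.Injective e) (σ τ : V → Bool) :
    hammingDist (σ ∘ e) (τ ∘ e) ≤ hammingDist σ τ := by
  classical
  unfold hammingDist
  refine Finset.card_le_card_of_injOn e ?_ he.injOn
  intro i hi
  simpa using hi

end GenericFormula

/-! ### Translation between `D`-paths and linkedness. -/

namespace KCNF

variable {k n m : ℕ}

theorem satisfies_iff (Φ : KCNF k n m) (σ : Assignment n) :
    Φ.Satisfies σ ↔ FamilySat (fun j => (Φ j).1) σ := Iff.rfl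

theorem mem_solutions (Φ : KCNF k n m) (σ : Assignment n) :
    σ ∈ Φ.solutions ↔ FamilySat (fun j => (Φ j).1) σ := by
  classical
  simp [solutions, satisfies_iff]

theorem DConnected.linked {Φ : KCNF k n m} {D : ℝ} {σ τ : Assignment n}
    (h : Φ.DConnected D σ τ) : Linked (fun j => (Φ j).1) D σ τ := by
  obtain ⟨ℓ, ζ, ⟨hs, hd⟩, rfl, rfl⟩ := h
  have : ∀ i : Fin (ℓ + 1), Linked (fun j => (Φ j).1) D (ζ 0) (ζ i) := by
    intro i
    induction i using Fin.induction with
    | zero => exact Relation.ReflTransGen.refl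
    | succ i ih => exact ih.tail ⟨hs _, hs _, hd i⟩
  exact this _

theorem dConnected_of_linked {Φ : KCNF k n m} {D : ℝ} {σ τ : Assignment n}
    (hσ : FamilySat (fun j => (Φ j).1) σ) (h : Linked (fun j => (Φ j).1) D σ τ) :
    Φ.DConnected D σ τ := by
  induction h with
  | refl => exact ⟨0, fun _ => σ, ⟨fun _ => hσ, fun i => i.elim0⟩, rfl, rfl⟩
  | @tail b c _ hbc ih =>
    obtain ⟨ℓ, ζ, ⟨hs, hd⟩, h0, h1⟩ := ih
    refine ⟨ℓ + 1, Fin.snoc (α := fun _ => Assignment n) ζ c, ⟨?_, ?_⟩, ?_, ?_⟩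
    · intro i
      refine Fin.lastCases ?_ (fun i => ?_) i
      · rw [Fin.snoc_last]; exact hbc.2.1
      · rw [Fin.snoc_castSucc]; exact hs i
    · intro i
      refine Fin.lastCases ?_ (fun i => ?_) i
      · rw [Fin.snoc_castSucc, h1, Fin.succ_last, Fin.snoc_last]; exact hbc.2.2
      · rw [Fin.snoc_castSucc, Fin.succ_castSucc, Fin.snoc_castSucc]; exact hd i
    · rw [← Fin.castSucc_zero, Fin.snoc_castSucc, h0]
    · rw [Fin.snoc_last]

end KCNF

/-! ### From linked pairs to a large class. -/

section Averaging

open scoped Classical in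
/-- If a symmetric transitive relation holds for most pairs of elements of `s`, then most
elements of `s` are related to a single one. -/
theorem exists_large_class {α : Type*} (s : Finset α) (hs : s.Nonempty) (R : α → α → Prop)
    (q : ℝ) (h : q * (s.card : ℝ) ^ 2 ≤ (((s ×ˢ s).filter fun p => R p.1 p.2).card : ℝ)) :
    ∃ a ∈ s, q * (s.card : ℝ) ≤ ((s.filter fun b => R a b).card : ℝ) := by
  by_contra! hcon
  have h1 : (((s ×ˢ s).filter fun p => R p.1 p.2).card : ℝ)
      = ∑ a ∈ s, ((s.filter fun b => R a b).card : ℝ) := by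
    rw [Finset.card_filter, Finset.sum_product]
    simp only [Finset.card_filter, Nat.cast_sum]
  have h2 : ∑ a ∈ s, ((s.filter fun b => R a b).card : ℝ) < ∑ a ∈ s, q * (s.card : ℝ) :=
    Finset.sum_lt_sum_of_nonempty hs hcon
  rw [Finset.sum_const, nsmul_eq_mul] at h2
  nlinarith

end Averaging

/-! ### Amplification by disjoint copies. -/

section Amplification

variable {V J : Type*} [Fintype V]

open scoped Classical in
/-- The assignments satisfying `F`. -/
noncomputable def solSet (F : J → Finset (V × Bool)) : Finset (V → Bool) :=
  Finset.univ.filter (FamilySat F)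

theorem mem_solSet {F : J → Finset (V × Bool)} {σ : V → Bool} :
    σ ∈ solSet F ↔ FamilySat F σ := by
  simp [solSet]

open scoped Classical in
/-- The number of clauses of the family `F` containing the variable `v`. -/
noncomputable def occCount {V J : Type*} [Fintype J] (F : J → Finset (V × Bool)) (v : V) : ℕ :=
  (Finset.univ.filter fun j => ∃ l ∈ F j, l.1 = v).card

theorem exists_finset_card_eq_occCount {V J : Type*} [Fintype J] (F : J → Finset (V × Bool))
    (v : V) : ∃ s : Finset J, occCount F v = s.card ∧ ∀ j, j ∈ s ↔ ∃ l ∈ F j, l.1 = v := by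
  classical
  exact ⟨_, rfl, fun j => by rw [Finset.mem_filter]; simp only [Finset.mem_univ, true_and]⟩

theorem IsKClause.map {V V' : Type*} {k : ℕ} {C : Finset (V × Bool)} (h : IsKClause k C)
    (f : V × Bool → V' × Bool) (hf : ∀ l ∈ C, ∀ l' ∈ C, (f l).1 = (f l').1 → l.1 = l'.1)
    [DecidableEq V'] : IsKClause k (C.image f) := by
  refine ⟨?_, ?_⟩
  · rw [Finset.card_image_of_injOn, h.1]
    intro a ha b hb hab
    exact h.2 a ha b hb (hf a ha b hb (by rw [hab]))
  · intro a ha b hb hab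
    obtain ⟨a', ha', rfl⟩ := Finset.mem_image.1 ha
    obtain ⟨b', hb', rfl⟩ := Finset.mem_image.1 hb
    rw [h.2 a' ha' b' hb' (hf a' ha' b' hb' hab)]

open scoped Classical in
/-- Connectivity of random pairs for formulas on the variables `Fin n` gives the same for formulas
with any finite set of variables and of clause indices. -/
theorem half_pairs_linked [Fintype J] {k d : ℕ} {D : ℝ} (F : J → Finset (V × Bool))
    (hF : ∀ j, IsKClause k (F j)) (hd : ∀ v, occCount F v ≤ d)
    (H : ∀ (m : ℕ) (Φ : KCNF k (Fintype.card V) m), Φ.IsBoundedDegree d →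
      Φ.RandomPairConnected D (1 / 2)) :
    (solSet F).Nonempty ∧ 1 / 2 * ((solSet F).card : ℝ) ^ 2 ≤
      (((solSet F ×ˢ solSet F).filter fun p => Linked F D p.1 p.2).card : ℝ) := by
  let e := Fintype.equivFin V
  let f := Fintype.equivFin J
  let Φ : KCNF k (Fintype.card V) (Fintype.card J) := fun i =>
    ⟨(F (f.symm i)).image fun l => (e l.1, l.2),
      (hF (f.symm i)).map _ fun _ _ _ _ h => e.injective h⟩
  have hsat : ∀ ω, FamilySat (fun j => (Φ j).1) ω ↔ FamilySat F (ω ∘ e) := by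
    intro ω
    constructor
    · intro h j
      obtain ⟨l, hl, hl'⟩ := h (f j)
      simp only [Φ, Finset.mem_image, Equiv.symm_apply_apply] at hl
      obtain ⟨a, ha, rfl⟩ := hl
      exact ⟨a, ha, hl'⟩
    · intro h j
      obtain ⟨a, ha, ha'⟩ := h (f.symm j)
      exact ⟨_, Finset.mem_image.2 ⟨a, ha, rfl⟩, ha'⟩
  have hdeg : Φ.IsBoundedDegree d := by
    intro v
    refine le_trans ?_ (hd (e.symm v))
    unfold KCNF.varDegree occCount
    refine Finset.card_le_card_of_injOn f.symm ?_ f.symm.injective.injOn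
    intro i hi
    simp only [Φ, Finset.coe_filter, Finset.mem_univ, true_and, Set.mem_ofPred_eq,
      Finset.mem_image] at hi ⊢
    obtain ⟨l, ⟨a, ha, rfl⟩, hv⟩ := hi
    exact ⟨a, ha, by rw [← hv]; simp⟩
  obtain ⟨⟨ω, hω⟩, hpr⟩ := H _ Φ hdeg
  rw [KCNF.mem_solutions, hsat] at hω
  refine ⟨⟨_, mem_solSet.2 hω⟩, ?_⟩
  have hcard : Φ.solutions.card = (solSet F).card := by
    refine Finset.card_nbij' (fun ω => ω ∘ e) (fun σ => σ ∘ e.symm) ?_ ?_ ?_ ?_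
    · intro ω hω
      exact mem_solSet.2 ((hsat ω).1 ((KCNF.mem_solutions _ _).1 hω))
    · intro σ hσ
      refine (KCNF.mem_solutions _ _).2 ((hsat _).2 ?_)
      have := mem_solSet.1 hσ
      convert this using 1
      funext v; simp
    · intro ω _; funext v; simp
    · intro σ _; funext v; simp
  have hpos : (0 : ℝ) < ((solSet F).card : ℝ) ^ 2 := by
    have : 0 < (solSet F).card := Finset.card_pos.2 ⟨_, mem_solSet.2 hω⟩
    positivity
  rw [uniformProb, Finset.card_product, hcard, le_div_iff₀ (by push_cast; nlinarith)] at hpr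
  refine le_trans (le_of_eq ?_) (hpr.trans ?_)
  · push_cast; ring
  · rw [Nat.cast_le]
    refine Finset.card_le_card_of_injOn (fun p => (p.1 ∘ e, p.2 ∘ e)) ?_ ?_
    · intro p hp
      simp only [Finset.coe_filter, Finset.mem_product, Set.mem_ofPred_eq, mem_solSet,
        KCNF.mem_solutions, hsat] at hp ⊢
      exact ⟨hp.1, hp.2.linked.map (fun ω => ω ∘ e) (fun ω => (hsat ω).1)
        (fun σ τ => hammingDist_comp_le e e.injective σ τ)⟩
    · intro p _ q _ h
      simp only [Prod.mk.injEq] at h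
      exact Prod.ext (e.surjective.injective_comp_right h.1) (e.surjective.injective_comp_right h.2)

/-- Since `(1 - 1 / M) ^ M ≤ 1 / e < 1 / 2`, an `M`-th power that retains half of `a ^ M` forces its
base to retain a fraction `1 - 1 / M` of `a`. -/
theorem one_sub_inv_mul_le_of_half_pow_le {M : ℕ} (hM : 1 ≤ M) {a c : ℝ} (ha : 0 < a) (hc : 0 ≤ c)
    (h : 1 / 2 * a ^ M ≤ c ^ M) : (1 - 1 / (M : ℝ)) * a ≤ c := by
  by_contra! hcon
  have hM' : (0 : ℝ) < M := by exact_mod_cast hM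
  have h1 : c ^ M < ((1 - 1 / (M : ℝ)) * a) ^ M := pow_lt_pow_left₀ hcon hc (by omega)
  have h2 : (1 - 1 / (M : ℝ)) ^ M ≤ Real.exp (-1) :=
    Real.one_sub_div_pow_le_exp_neg (by exact_mod_cast hM)
  have h3 : Real.exp (-1) < 1 / 2 := by
    rw [Real.exp_neg, one_div]
    exact inv_strictAnti₀ (by norm_num) (lt_trans (by norm_num) Real.exp_one_gt_d9)
  rw [mul_pow] at h1
  have h4 : (0 : ℝ) < a ^ M := by positivity
  nlinarith

open scoped Classical in
/-- Applying connectivity of random pairs to `M` disjoint copies of a formula shows that all but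
a fraction `1 / M` of its solutions are linked to one of them. -/
theorem exists_large_linked_class [Fintype J] {k d M : ℕ} (hM : 1 ≤ M) {D : ℝ} (F : J → Finset (V × Bool))
    (hF : ∀ j, IsKClause k (F j)) (hd : ∀ v, occCount F v ≤ d)
    (H : ∀ (m : ℕ) (Φ : KCNF k (M * Fintype.card V) m), Φ.IsBoundedDegree d →
      Φ.RandomPairConnected D (1 / 2)) :
    ∃ σ, FamilySat F σ ∧ (1 - 1 / (M : ℝ)) * ((solSet F).card : ℝ) ≤
      (((solSet F).filter fun τ => Linked F D σ τ).card : ℝ) := by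
  let F' : Fin M × J → Finset ((Fin M × V) × Bool) := fun p =>
    (F p.2).image fun l => ((p.1, l.1), l.2)
  have hF' : ∀ p, IsKClause k (F' p) := fun p =>
    (hF p.2).map _ fun _ _ _ _ h => congrArg Prod.snd h
  have hsat : ∀ ω, FamilySat F' ω ↔ ∀ i, FamilySat F (fun v => ω (i, v)) := by
    intro ω
    constructor
    · intro h i j
      obtain ⟨l, hl, hl'⟩ := h (i, j)
      obtain ⟨a, ha, rfl⟩ := Finset.mem_image.1 hl
      exact ⟨a, ha, hl'⟩
    · intro h p
      obtain ⟨a, ha, ha'⟩ := h p.1 p.2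
      exact ⟨_, Finset.mem_image.2 ⟨a, ha, rfl⟩, ha'⟩
  have hd' : ∀ v, occCount F' v ≤ d := by
    rintro ⟨i, v⟩
    refine le_trans ?_ (hd v)
    refine Finset.card_le_card_of_injOn Prod.snd ?_ ?_
    · intro p hp
      simp only [Finset.coe_filter, Finset.mem_univ, true_and, Set.mem_ofPred_eq, F',
        Finset.mem_image] at hp ⊢
      obtain ⟨l, ⟨a, ha, rfl⟩, hv⟩ := hp
      exact ⟨a, ha, congrArg Prod.snd hv⟩
    · intro p hp q hq hpq
      simp only [Finset.coe_filter, Finset.mem_univ, true_and, Set.mem_ofPred_eq, F',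
        Finset.mem_image] at hp hq
      obtain ⟨l, ⟨a, ha, rfl⟩, hv⟩ := hp
      obtain ⟨l', ⟨a', ha', rfl⟩, hv'⟩ := hq
      exact Prod.ext ((congrArg Prod.fst hv).trans (congrArg Prod.fst hv').symm) hpq
  obtain ⟨⟨ω, hω⟩, hhalf⟩ := half_pairs_linked (D := D) F' hF' hd' (by
    rw [Fintype.card_prod, Fintype.card_fin]; exact H)
  rw [mem_solSet, hsat] at hω
  have hne : (solSet F).Nonempty := ⟨_, mem_solSet.2 (hω ⟨0, hM⟩)⟩
  have h1 : (solSet F).card ^ M ≤ (solSet F').card := by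
    have : (Fintype.piFinset fun _ : Fin M => solSet F).card = (solSet F).card ^ M := by simp
    rw [← this]
    refine Finset.card_le_card_of_injOn (fun x p => x p.1 p.2) ?_ ?_
    · intro x hx
      simp only [Finset.mem_coe, mem_solSet, Fintype.mem_piFinset] at hx ⊢
      exact (hsat _).2 hx
    · intro x _ y _ h
      funext i v
      exact congrFun h (i, v)
  -- A path in the disjoint union projects to a path in each copy with moves no longer, so linked
  -- pairs of the union inject into `M`-tuples of linked pairs of `F`.
  have h2 : (((solSet F' ×ˢ solSet F').filter fun p => Linked F' D p.1 p.2).card)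
      ≤ (((solSet F ×ˢ solSet F).filter fun p => Linked F D p.1 p.2).card) ^ M := by
    have : (Fintype.piFinset fun _ : Fin M =>
        ((solSet F ×ˢ solSet F).filter fun p => Linked F D p.1 p.2)).card =
        (((solSet F ×ˢ solSet F).filter fun p => Linked F D p.1 p.2).card) ^ M := by simp
    rw [← this]
    refine Finset.card_le_card_of_injOn
      (fun p i => ((fun v => p.1 (i, v)), (fun v => p.2 (i, v)))) ?_ ?_
    · intro p hp
      simp only [Finset.coe_filter, Finset.mem_product, Set.mem_ofPred_eq, mem_solSet,
        Finset.mem_coe, Fintype.mem_piFinset, Finset.mem_filter, hsat] at hp ⊢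
      intro i
      refine ⟨⟨hp.1.1 i, hp.1.2 i⟩, hp.2.map (fun ω v => ω (i, v)) (fun ω h => (hsat ω).1 h i) ?_⟩
      intro σ τ
      exact hammingDist_comp_le (fun v => (i, v)) (Prod.mk_right_injective i) σ τ
    · intro p _ q _ h
      refine Prod.ext (funext fun x => ?_) (funext fun x => ?_)
      · exact congrFun (congrArg Prod.fst (congrFun h x.1)) x.2
      · exact congrFun (congrArg Prod.snd (congrFun h x.1)) x.2
  have hpos : (0 : ℝ) < ((solSet F).card : ℝ) := by exact_mod_cast hne.card_pos
  have h3 : 1 / 2 * (((solSet F).card : ℝ) ^ 2) ^ M ≤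
      (((solSet F ×ˢ solSet F).filter fun p => Linked F D p.1 p.2).card : ℝ) ^ M := by
    calc 1 / 2 * (((solSet F).card : ℝ) ^ 2) ^ M
        = 1 / 2 * (((solSet F).card : ℝ) ^ M) ^ 2 := by ring
      _ ≤ 1 / 2 * ((solSet F').card : ℝ) ^ 2 := by
        have : ((solSet F).card : ℝ) ^ M ≤ ((solSet F').card : ℝ) := by exact_mod_cast h1
        gcongr
      _ ≤ _ := hhalf.trans (by exact_mod_cast h2)
  obtain ⟨σ, hσ, h⟩ := exists_large_class (solSet F) hne (Linked F D) (1 - 1 / (M : ℝ))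
    (one_sub_inv_mul_le_of_half_pow_le hM (by positivity) (by positivity) h3)
  exact ⟨σ, mem_solSet.1 hσ, h⟩

end Amplification

/-! ### Combining assignments on and off a set of variables. -/

section PartialAssignments

variable {V : Type*}

open scoped Classical in
/-- The assignment that agrees with `τ` on `B` and with `ρ` off `B`. -/
noncomputable def mix (B : Finset V) (τ ρ : V → Bool) : V → Bool :=
  fun v => if v ∈ B then τ v else ρ v

theorem mix_mix (B : Finset V) (x y : V → Bool) : mix B (mix B x y) (mix B y x) = x := by
  funext v; unfold mix; split_ifs <;> rfl

/-- Exchanging `τ` and `ρ` off `B` is an involution on pairs. It allows fibres to be summed over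
total assignments: the values of `τ` off `B` and of `ρ` on `B` are redundant and account for the
factor on the right. -/
theorem sum_card_fiber_mix (B : Finset V) [Fintype (V → Bool)] (T : Finset (V → Bool))
    (R : (V → Bool) → Finset (V → Bool)) (hR : ∀ τ ρ, ρ ∈ R τ ↔ mix B τ ρ ∈ T) :
    ∑ τ, (R τ).card = T.card * Fintype.card (V → Bool) := by
  rw [← Finset.card_univ, ← Finset.card_product, ← Finset.card_sigma]
  refine Finset.card_nbij' (fun x => (mix B x.1 x.2, mix B x.2 x.1))
    (fun x => ⟨mix B x.1 x.2, mix B x.2 x.1⟩) ?_ ?_ ?_ ?_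
  · rintro ⟨τ, ρ⟩ hx
    simpa [hR] using hx
  · rintro ⟨x, y⟩ hx
    simpa [hR, mix_mix] using hx
  · rintro ⟨τ, ρ⟩ _
    simp only [mix_mix]
  · rintro ⟨x, y⟩ _
    simp only [mix_mix]

theorem hammingDist_mix_le [Fintype V] (B : Finset V) (τ τ' ρ : V → Bool) :
    hammingDist (mix B τ ρ) (mix B τ' ρ) ≤ hammingDist τ τ' := by
  classical
  refine Finset.card_le_card ?_
  intro v hv
  have hv := (Finset.mem_filter.1 hv).2
  refine Finset.mem_filter.2 ⟨Finset.mem_univ _, ?_⟩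
  by_cases hB : v ∈ B <;> simp_all [mix]

theorem hammingDist_mix_le' [Fintype V] (B : Finset V) (τ ρ ρ' : V → Bool) :
    hammingDist (mix B τ ρ) (mix B τ ρ') ≤ hammingDist ρ ρ' := by
  classical
  refine Finset.card_le_card ?_
  intro v hv
  have hv := (Finset.mem_filter.1 hv).2
  refine Finset.mem_filter.2 ⟨Finset.mem_univ _, ?_⟩
  by_cases hB : v ∈ B <;> simp_all [mix]

end PartialAssignments

/-! ### Residual formulas and their padding. -/

section Residual

variable {V J : Type*}

/-- No literal of clause `j` on a variable of `B` is satisfied by `τ`. -/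
def Active (F : J → Finset (V × Bool)) (B : Finset V) (τ : V → Bool) (j : J) : Prop :=
  ∀ l ∈ F j, l.1 ∈ B → τ l.1 ≠ l.2

theorem familySat_mix {F : J → Finset (V × Bool)} {B : Finset V} {τ ρ : V → Bool} :
    FamilySat F (mix B τ ρ) ↔ ∀ j, Active F B τ j → ∃ l ∈ F j, l.1 ∉ B ∧ ρ l.1 = l.2 := by
  classical
  constructor
  · intro h j hj
    obtain ⟨l, hl, hl'⟩ := h j
    by_cases hB : l.1 ∈ B
    · simp only [mix, hB, if_true] at hl'
      exact absurd hl' (hj l hl hB)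
    · simp only [mix, hB, if_false] at hl'
      exact ⟨l, hl, hB, hl'⟩
  · intro h j
    by_cases hj : Active F B τ j
    · obtain ⟨l, hl, hB, hl'⟩ := h j hj
      exact ⟨l, hl, by simp [mix, hB, hl']⟩
    · unfold Active at hj
      push Not at hj
      obtain ⟨l, hl, hB, hl'⟩ := hj
      exact ⟨l, hl, by simp [mix, hB, hl']⟩

open scoped Classical in
/-- The assignments that satisfy `F` when combined with `τ` on `B`. -/
noncomputable def fiberSol [Fintype V] (F : J → Finset (V × Bool)) (B : Finset V) (τ : V → Bool) :
    Finset (V → Bool) :=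
  Finset.univ.filter fun ρ => FamilySat F (mix B τ ρ)

theorem mem_fiberSol [Fintype V] {F : J → Finset (V × Bool)} {B : Finset V} {τ ρ : V → Bool} :
    ρ ∈ fiberSol F B τ ↔ FamilySat F (mix B τ ρ) := by
  simp [fiberSol]

/-- The coordinates `(v, some j)` are unconstrained, and there are `|V| |J|` of them. -/
theorem card_eq_of_mem_iff_none [Fintype V] [Fintype J] (S : Finset (V × Option J → Bool))
    (T : Finset (V → Bool)) (h : ∀ ω, ω ∈ S ↔ (fun v => ω (v, none)) ∈ T) :
    S.card = T.card * 2 ^ (Fintype.card V * Fintype.card J) := by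
  classical
  have hN : (Finset.univ : Finset (V × J → Bool)).card =
      2 ^ (Fintype.card V * Fintype.card J) := by simp
  rw [← hN, ← Finset.card_product]
  refine Finset.card_nbij' (fun ω => (fun v => ω (v, none), fun x => ω (x.1, some x.2)))
    (fun x y => match y with
      | (v, none) => x.1 v
      | (v, some j) => x.2 (v, j)) ?_ ?_ ?_ ?_
  · intro ω hω
    simpa using (h ω).1 hω
  · intro x hx
    rw [Finset.mem_coe, h]
    simpa using hx
  · intro ω _
    funext ⟨v, o⟩
    cases o <;> rfl
  · intro x _
    rfl

open scoped Classical in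
/-- The literals of a clause over `B`, replaced by literals over fresh variables with signs
prescribed by `T`. -/
noncomputable def padLiteral (B T : Finset V) (j : J) (l : V × Bool) : (V × Option J) × Bool :=
  if l.1 ∈ B then ((l.1, some j), decide (l.1 ∈ T)) else ((l.1, none), l.2)

open scoped Classical in
/-- The variables of `B` that occur in clause `j`. -/
noncomputable def boundVars (F : J → Finset (V × Bool)) (B : Finset V) (j : J) : Finset V :=
  B.filter fun v => ∃ l ∈ F j, l.1 = v

theorem mem_boundVars {F : J → Finset (V × Bool)} {B : Finset V} {j : J} {v : V} :
    v ∈ boundVars F B j ↔ v ∈ B ∧ ∃ l ∈ F j, l.1 = v := by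
  classical
  rw [boundVars, Finset.mem_filter]

/-- The indices of the padded formula: an active clause and a sign pattern of its variables
in `B`. -/
abbrev PadIndex (F : J → Finset (V × Bool)) (B : Finset V) (τ : V → Bool) : Type _ :=
  {p : J × Finset V // Active F B τ p.1 ∧ p.2 ⊆ boundVars F B p.1}

open scoped Classical in
/-- The residual formula on the variables off `B` after assigning `τ` on `B`, with clauses padded
to their original size: each shortened clause is replaced by its extensions by all sign patterns
on fresh variables. -/
noncomputable def padded (F : J → Finset (V × Bool)) (B : Finset V) (τ : V → Bool)
    (p : PadIndex F B τ) : Finset ((V × Option J) × Bool) :=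
  (F p.1.1).image (padLiteral B p.1.2 p.1.1)

noncomputable instance [Fintype V] [Fintype J] (F : J → Finset (V × Bool)) (B : Finset V)
    (τ : V → Bool) : Fintype (PadIndex F B τ) :=
  Fintype.ofFinite _

/-- For any values of the fresh variables of clause `j`, one sign pattern `T` makes all its padding
literals false: the set of those that are false under `ω`. That extension is satisfied only through
the residual clause, which in turn satisfies every extension. -/
theorem familySat_padded {F : J → Finset (V × Bool)} {B : Finset V} {τ : V → Bool}
    {ω : V × Option J → Bool} :
    FamilySat (padded F B τ) ω ↔ FamilySat F (mix B τ fun v => ω (v, none)) := by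
  classical
  rw [familySat_mix]
  constructor
  · intro h j hj
    let T : Finset V := (boundVars F B j).filter fun v => ω (v, some j) = false
    obtain ⟨l, hl, hl'⟩ := h ⟨(j, T), hj, Finset.filter_subset _ _⟩
    obtain ⟨a, ha, rfl⟩ := Finset.mem_image.1 hl
    by_cases hB : a.1 ∈ B
    · exfalso
      have hb : a.1 ∈ boundVars F B j := Finset.mem_filter.2 ⟨hB, a, ha, rfl⟩
      simp only [padLiteral, hB, if_true, T, Finset.mem_filter, hb, true_and] at hl'
      cases hω : ω (a.1, some j) <;> simp [hω] at hl'
    · simp only [padLiteral, hB, if_false] at hl'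
      exact ⟨a, ha, hB, hl'⟩
  · rintro h ⟨⟨j, T⟩, hj, hT⟩
    obtain ⟨l, hl, hB, hl'⟩ := h j hj
    refine ⟨_, Finset.mem_image.2 ⟨l, hl, rfl⟩, ?_⟩
    simpa [padLiteral, hB] using hl'

/-- Each active clause has at most `2 ^ 3 = 8` padded versions. An old variable off `B` meets at
most `d` original clauses, an old variable in `B` no longer occurs, and a fresh variable `(v, some
j)` comes from clause `j` only, whence `1 ≤ d`. -/
theorem occCount_padded_le [Fintype V] [Fintype J] {F : J → Finset (V × Bool)} {B : Finset V} {τ : V → Bool} {d : ℕ}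
    (hd1 : 1 ≤ d) (hd : ∀ v ∉ B, occCount F v ≤ d)
    (hB : ∀ j, Active F B τ j → (boundVars F B j).card ≤ 3) (x : V × Option J) :
    occCount (padded F B τ) x ≤ 8 * d := by
  classical
  obtain ⟨v, o⟩ := x
  obtain ⟨s, hs, hmem⟩ : ∃ s : Finset (PadIndex F B τ), occCount (padded F B τ) (v, o) = s.card ∧
      ∀ p ∈ s, ∃ l ∈ padded F B τ p, l.1 = (v, o) :=
    (exists_finset_card_eq_occCount _ _).imp fun s hs => ⟨hs.1, fun p => (hs.2 p).1⟩
  rw [hs]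
  have himage : (s.image fun p => p.1.1).card ≤ d := by
    have hkey : ∀ j ∈ s.image fun p => p.1.1,
        ∃ l ∈ F j, l.1 = v ∧ ((l.1 ∉ B ∧ o = none) ∨ o = some j) := by
      intro j hj
      obtain ⟨p, hp, rfl⟩ := Finset.mem_image.1 hj
      obtain ⟨l, hl, hlv⟩ := hmem p hp
      obtain ⟨a, ha, rfl⟩ := Finset.mem_image.1 hl
      by_cases haB : a.1 ∈ B
      · simp only [padLiteral, haB, if_true, Prod.mk.injEq] at hlv
        exact ⟨a, ha, hlv.1, Or.inr hlv.2.symm⟩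
      · simp only [padLiteral, haB, if_false, Prod.mk.injEq] at hlv
        exact ⟨a, ha, hlv.1, Or.inl ⟨haB, hlv.2.symm⟩⟩
    cases o with
    | none =>
      by_cases hv : v ∈ B
      · have : s.image (fun p => p.1.1) = ∅ := by
          rw [Finset.eq_empty_iff_forall_notMem]
          intro j hj
          obtain ⟨l, _, rfl, h | h⟩ := hkey j hj
          · exact h.1 hv
          · cases h
        simp [this]
      · refine le_trans (Finset.card_le_card ?_) (hd v hv)
        intro j hj
        obtain ⟨l, hl, hlv, _⟩ := hkey j hj
        exact Finset.mem_filter.2 ⟨Finset.mem_univ _, l, hl, hlv⟩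
    | some i =>
      refine le_trans (Finset.card_le_one.2 ?_) hd1
      intro a ha b hb
      obtain ⟨_, _, _, h | h⟩ := hkey a ha
      · cases h.2
      · obtain ⟨_, _, _, h' | h'⟩ := hkey b hb
        · cases h'.2
        · exact (Option.some_injective _ h).symm.trans (Option.some_injective _ h')
  refine (Finset.card_le_mul_card_image (f := fun p : PadIndex F B τ => p.1.1) s 8 ?_).trans
    (Nat.mul_le_mul_left _ himage)
  intro j hj
  obtain ⟨p, hp, rfl⟩ := Finset.mem_image.1 hj
  calc _ ≤ (boundVars F B p.1.1).powerset.card := by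
        refine Finset.card_le_card_of_injOn (fun q => q.1.2) ?_ ?_
        · intro q hq
          have hq := (Finset.mem_filter.1 hq).2
          rw [Finset.mem_coe, Finset.mem_powerset, ← hq]
          exact q.2.2
        · intro q hq q' hq' h
          have hq := (Finset.mem_filter.1 hq).2
          have hq' := (Finset.mem_filter.1 hq').2
          exact Subtype.ext (Prod.ext (hq.trans hq'.symm) h)
    _ ≤ 8 := by
        rw [Finset.card_powerset]
        exact (Nat.pow_le_pow_right (by norm_num) (hB _ p.2.1)).trans (by norm_num)

open scoped Classical in
/-- In every fiber over a partial assignment, all but a fraction `1 / M` of the solutions are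
linked to one of them. -/
theorem exists_large_linked_fiber [Fintype V] [Fintype J] {k d M : ℕ} (hM : 1 ≤ M) {D : ℝ} (F : J → Finset (V × Bool))
    (hF : ∀ j, IsKClause k (F j)) (B : Finset V) (τ : V → Bool) (hd1 : 1 ≤ d)
    (hd : ∀ v ∉ B, occCount F v ≤ d)
    (hB : ∀ j, Active F B τ j → (boundVars F B j).card ≤ 3)
    (H : ∀ (m : ℕ) (Φ : KCNF k (M * (Fintype.card V * (Fintype.card J + 1))) m),
      Φ.IsBoundedDegree (8 * d) → Φ.RandomPairConnected D (1 / 2)) :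
    ∃ ρ ∈ fiberSol F B τ, (1 - 1 / (M : ℝ)) * ((fiberSol F B τ).card : ℝ) ≤
      (((fiberSol F B τ).filter fun ρ' => Linked F D (mix B τ ρ) (mix B τ ρ')).card : ℝ) := by
  have hpad : ∀ p, IsKClause k (padded F B τ p) := by
    intro p
    refine (hF p.1.1).map _ ?_
    intro l _ l' _ h
    unfold padLiteral at h
    split_ifs at h <;> simp_all
  obtain ⟨ω, hω, hcard⟩ := exists_large_linked_class (D := D) hM (padded F B τ) hpad
    (occCount_padded_le hd1 hd hB) (by
      rw [Fintype.card_prod, Fintype.card_option]; exact H)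
  refine ⟨fun v => ω (v, none), mem_fiberSol.2 (familySat_padded.1 hω), ?_⟩
  have h1 : (solSet (padded F B τ)).card =
      (fiberSol F B τ).card * 2 ^ (Fintype.card V * Fintype.card J) :=
    card_eq_of_mem_iff_none _ _ fun ω => by rw [mem_solSet, mem_fiberSol, familySat_padded]
  have h2 : ((solSet (padded F B τ)).filter fun ω' => Linked (padded F B τ) D ω ω').card ≤
      ((fiberSol F B τ).filter fun ρ' => Linked F D (mix B τ fun v => ω (v, none))
        (mix B τ ρ')).card * 2 ^ (Fintype.card V * Fintype.card J) := by
    rw [← card_eq_of_mem_iff_none (Finset.univ.filter fun ω' : V × Option J → Bool =>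
      (fun v => ω' (v, none)) ∈ (fiberSol F B τ).filter fun ρ' =>
        Linked F D (mix B τ fun v => ω (v, none)) (mix B τ ρ')) _ (by simp)]
    refine Finset.card_le_card ?_
    intro ω' hω'
    rw [Finset.mem_filter, mem_solSet, familySat_padded] at hω'
    refine Finset.mem_filter.2 ⟨Finset.mem_univ _, Finset.mem_filter.2
      ⟨mem_fiberSol.2 hω'.1, hω'.2.map (fun ω => mix B τ fun v => ω (v, none))
      (fun σ => familySat_padded.1) ?_⟩⟩
    intro σ σ'
    exact (hammingDist_mix_le' _ _ _ _).trans
      (hammingDist_comp_le (fun v => (v, none)) (fun a b h => congrArg Prod.fst h) σ σ')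
  have hpos : (0 : ℝ) < (2 : ℝ) ^ (Fintype.card V * Fintype.card J) := by positivity
  refine le_of_mul_le_mul_right ?_ hpos
  rw [h1] at hcard
  push_cast at hcard
  rw [mul_assoc]
  exact hcard.trans (by exact_mod_cast h2)

end Residual

/-! ### A counting form of the local lemma. -/

section LocalLemma

variable {V J : Type*} [Fintype V]

open scoped Classical in
/-- The assignments satisfying the clauses of `G` with indices in `A`. -/
noncomputable def partialSol (G : J → Finset (V × Bool)) (A : Finset J) : Finset (V → Bool) :=
  Finset.univ.filter fun ρ => ∀ j ∈ A, ∃ l ∈ G j, ρ l.1 = l.2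

theorem mem_partialSol {G : J → Finset (V × Bool)} {A : Finset J} {ρ : V → Bool} :
    ρ ∈ partialSol G A ↔ ∀ j ∈ A, ∃ l ∈ G j, ρ l.1 = l.2 := by
  simp [partialSol]

theorem partialSol_anti {G : J → Finset (V × Bool)} {A A' : Finset J} (h : A ⊆ A') :
    partialSol G A' ⊆ partialSol G A := fun _ hρ =>
  mem_partialSol.2 fun j hj => mem_partialSol.1 hρ j (h hj)

open scoped Classical in
/-- A clause is violated by at most a fraction `2 ^ (-|C|)` of a set of assignments which does not
depend on the variables of the clause. -/
theorem pow_mul_card_violating_le (C : Finset (V × Bool))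
    (hC : ∀ l ∈ C, ∀ l' ∈ C, l.1 = l'.1 → l = l') (X : Finset (V → Bool))
    (hX : ∀ ρ ∈ X, ∀ ρ' : V → Bool, (∀ v, (∀ l ∈ C, l.1 ≠ v) → ρ v = ρ' v) → ρ' ∈ X) :
    2 ^ C.card * (X.filter fun ρ => ∀ l ∈ C, ρ l.1 ≠ l.2).card ≤ X.card := by
  rw [← Finset.card_powerset, ← Finset.card_product]
  have hval : ∀ (T : Finset (V × Bool)) (ρ : V → Bool), T ⊆ C → (∀ l ∈ C, ρ l.1 ≠ l.2) →
      ∀ l ∈ C, (l ∈ T ↔ (if ∃ l' ∈ T, l'.1 = l.1 then !ρ l.1 else ρ l.1) = l.2) := by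
    intro T ρ hT hρ l hl
    have h1 : (∃ l' ∈ T, l'.1 = l.1) ↔ l ∈ T :=
      ⟨fun ⟨l', hl', h⟩ => hC l' (hT hl') l hl h ▸ hl', fun h => ⟨l, h, rfl⟩⟩
    have h2 := hρ l hl
    simp only [h1]
    split_ifs with h
    · simp only [h, true_iff]
      cases h3 : ρ l.1 <;> cases h4 : l.2 <;> simp_all
    · simpa [h] using h2
  -- Flip a violating `ρ` on the variables of a subset `T` of the clause. The result satisfies
  -- exactly the literals in `T` (this is `hval`), so it determines `T` and then `ρ`.
  refine Finset.card_le_card_of_injOn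
    (fun p v => if ∃ l' ∈ p.1, l'.1 = v then !p.2 v else p.2 v) ?_ ?_
  · rintro ⟨T, ρ⟩ hp
    simp only [Finset.coe_product, Set.mem_prod, Finset.mem_coe, Finset.mem_powerset,
      Finset.mem_filter] at hp
    refine hX ρ hp.2.1 _ ?_
    intro v hv
    dsimp only
    rw [if_neg]
    rintro ⟨l, hl, hlv⟩
    exact hv l (hp.1 hl) hlv
  · rintro ⟨T, ρ⟩ hp ⟨T', ρ'⟩ hp' h
    simp only [Finset.coe_product, Set.mem_prod, Finset.mem_coe, Finset.mem_powerset,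
      Finset.mem_filter] at hp hp'
    have hTT : T = T' := by
      ext l
      constructor
      · intro hl
        have := (hval T ρ hp.1 hp.2.2 l (hp.1 hl)).1 hl
        rw [hval T' ρ' hp'.1 hp'.2.2 l (hp.1 hl)]
        rw [← this]
        exact (congrFun h l.1).symm
      · intro hl
        have := (hval T' ρ' hp'.1 hp'.2.2 l (hp'.1 hl)).1 hl
        rw [hval T ρ hp.1 hp.2.2 l (hp'.1 hl)]
        rw [← this]
        exact congrFun h l.1
    subst hTT
    refine Prod.ext rfl ?_
    funext v
    have := congrFun h v
    simp only at this
    split_ifs at this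
    · exact Bool.not_inj this
    · exact this

/-- If adding one clause to a set of fewer than `N` clauses keeps a fraction `y` of the solutions,
then adding several keeps the corresponding power of `y`. -/
theorem pow_mul_card_partialSol_le {G : J → Finset (V × Bool)} {A : Finset J} {y : ℝ}
    (hy : 0 ≤ y) {N : ℕ} [DecidableEq J]
    (h : ∀ A' ⊆ A, A'.card < N → ∀ j ∈ A,
      y * ((partialSol G A').card : ℝ) ≤ ((partialSol G (insert j A')).card : ℝ))
    (E : Finset J) (hE : E ⊆ A) : ∀ A₁ ⊆ A, Disjoint A₁ E → (A₁ ∪ E).card ≤ N →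
      y ^ E.card * ((partialSol G A₁).card : ℝ) ≤ ((partialSol G (A₁ ∪ E)).card : ℝ) := by
  induction E using Finset.induction_on with
  | empty => intro A₁ _ _ _; simp
  | insert j E hj ih =>
    intro A₁ hA₁ hdisj hcard
    rw [Finset.disjoint_insert_right] at hdisj
    have hun : A₁ ∪ insert j E = insert j (A₁ ∪ E) := Finset.union_insert _ _ _
    have hnot : j ∉ A₁ ∪ E := by simp [hj, hdisj.1]
    rw [hun, Finset.card_insert_of_notMem hnot] at hcard
    have hEA : E ⊆ A := (Finset.subset_insert _ _).trans hE
    have h1 := ih hEA A₁ hA₁ hdisj.2 (by omega)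
    have h2 := h (A₁ ∪ E) (Finset.union_subset hA₁ hEA) (by omega) j
      (hE (Finset.mem_insert_self _ _))
    rw [hun, Finset.card_insert_of_notMem hj, pow_succ']
    calc y * y ^ E.card * ((partialSol G A₁).card : ℝ)
        = y * (y ^ E.card * ((partialSol G A₁).card : ℝ)) := by ring
      _ ≤ y * ((partialSol G (A₁ ∪ E)).card : ℝ) := by gcongr
      _ ≤ _ := h2

open scoped Classical in
/-- The local lemma, one clause at a time. -/
theorem card_partialSol_insert_ge {G : J → Finset (V × Bool)} {A : Finset J} {K Δ : ℕ} {x : ℝ}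
    (hx0 : 0 ≤ x) (hx1 : x ≤ 1) (hx : (1 / 2 : ℝ) ^ K ≤ x * (1 - x) ^ Δ)
    (hG : ∀ j ∈ A, ∀ l ∈ G j, ∀ l' ∈ G j, l.1 = l'.1 → l = l')
    (hK : ∀ j ∈ A, K ≤ (G j).card)
    (hΔ : ∀ j ∈ A, (A.filter fun i => ∃ l ∈ G j, ∃ l' ∈ G i, l'.1 = l.1).card ≤ Δ) (N : ℕ) :
    ∀ A' ⊆ A, A'.card < N → ∀ j ∈ A,
      (1 - x) * ((partialSol G A').card : ℝ) ≤ ((partialSol G (insert j A')).card : ℝ) := by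
  induction N with
  | zero => intro A' _ h; omega
  | succ N ih =>
    intro A' hA' hcard j hj
    -- `E` consists of the clauses sharing a variable with clause `j`, and `A₀` of the others. Among
    -- solutions of `A₀`, clause `j` fails with frequency at most `2 ^ (-K)`. By induction,
    -- restoring the at most `Δ` clauses of `E` keeps a fraction `(1 - x) ^ Δ`, so the failures
    -- number at most a fraction `x` of the solutions of `A'`.
    set E := A'.filter fun i => ∃ l ∈ G j, ∃ l' ∈ G i, l'.1 = l.1 with hE
    set A₀ := A'.filter fun i => ¬ ∃ l ∈ G j, ∃ l' ∈ G i, l'.1 = l.1 with hA₀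
    have hunion : A₀ ∪ E = A' := by
      rw [Finset.union_comm]; exact Finset.filter_union_filter_not_eq _ _
    have hdisj : Disjoint A₀ E := (Finset.disjoint_filter_filter_not _ _ _).symm
    have hEc : E.card ≤ Δ :=
      (Finset.card_le_card (Finset.filter_subset_filter _ hA')).trans (hΔ j hj)
    have hy : 0 ≤ 1 - x := by linarith
    have h1 := pow_mul_card_partialSol_le hy ih E ((Finset.filter_subset _ _).trans hA') A₀
      ((Finset.filter_subset _ _).trans hA') hdisj (by rw [hunion]; omega)
    rw [hunion] at h1
    have h2 := pow_mul_card_violating_le (G j) (hG j hj) (partialSol G A₀) (by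
      intro ρ hρ ρ' hρρ'
      rw [mem_partialSol] at hρ ⊢
      intro i hi
      obtain ⟨l, hl, hl'⟩ := hρ i hi
      refine ⟨l, hl, ?_⟩
      rw [← hρρ' l.1 ?_]
      · exact hl'
      · intro l₁ hl₁ h
        exact (Finset.mem_filter.1 hi).2 ⟨l₁, hl₁, l, hl, h.symm⟩)
    set W := (partialSol G A₀).filter fun ρ => ∀ l ∈ G j, ρ l.1 ≠ l.2 with hW
    have h3 : (partialSol G A').card ≤ (partialSol G (insert j A')).card + W.card := by
      refine (Finset.card_le_card ?_).trans (Finset.card_union_le _ _)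
      intro ρ hρ
      by_cases hv : ∃ l ∈ G j, ρ l.1 = l.2
      · refine Finset.mem_union_left _ (mem_partialSol.2 ?_)
        intro i hi
        rcases Finset.mem_insert.1 hi with rfl | hi
        · exact hv
        · exact mem_partialSol.1 hρ i hi
      · push Not at hv
        exact Finset.mem_union_right _ (Finset.mem_filter.2
          ⟨partialSol_anti (Finset.filter_subset _ _) hρ, hv⟩)
    have h4 : (2 : ℝ) ^ K * (W.card : ℝ) ≤ ((partialSol G A₀).card : ℝ) := by
      calc (2 : ℝ) ^ K * (W.card : ℝ) ≤ (2 : ℝ) ^ (G j).card * (W.card : ℝ) := by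
            have := hK j hj
            gcongr
            norm_num
        _ ≤ _ := by exact_mod_cast h2
    have h5 : (W.card : ℝ) ≤ x * ((partialSol G A').card : ℝ) := by
      calc (W.card : ℝ) = (1 / 2 : ℝ) ^ K * ((2 : ℝ) ^ K * (W.card : ℝ)) := by
            rw [← mul_assoc, ← mul_pow]; norm_num
        _ ≤ (x * (1 - x) ^ Δ) * ((partialSol G A₀).card : ℝ) := by gcongr
        _ ≤ (x * (1 - x) ^ E.card) * ((partialSol G A₀).card : ℝ) := by
            have : (1 - x) ^ Δ ≤ (1 - x) ^ E.card :=
              pow_le_pow_of_le_one hy (by linarith) hEc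
            gcongr
        _ = x * ((1 - x) ^ E.card * ((partialSol G A₀).card : ℝ)) := by ring
        _ ≤ _ := by gcongr
    have h6 : ((partialSol G A').card : ℝ) ≤ (partialSol G (insert j A')).card + W.card := by
      exact_mod_cast h3
    linarith

open scoped Classical in
/-- Adding clauses to a formula of small degree keeps at least a fraction `1 / 2` of the solutions
for each clause. -/
theorem half_pow_mul_card_partialSol_le [Fintype J] {G : J → Finset (V × Bool)} {A : Finset J}
    {K k d : ℕ} (hK2 : 2 ≤ K) (hkd : 4 * (k * d) ≤ 2 ^ K)
    (hG : ∀ j ∈ A, ∀ l ∈ G j, ∀ l' ∈ G j, l.1 = l'.1 → l = l')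
    (hK : ∀ j ∈ A, K ≤ (G j).card) (hk : ∀ j ∈ A, (G j).card ≤ k)
    (hd : ∀ j, ∀ l ∈ G j, occCount G l.1 ≤ d) {A₁ A₂ : Finset J} (h12 : A₁ ⊆ A₂) (h2 : A₂ ⊆ A) :
    (1 / 2 : ℝ) ^ (A₂ \ A₁).card * ((partialSol G A₁).card : ℝ) ≤
      ((partialSol G A₂).card : ℝ) := by
  have hx : (1 / 2 : ℝ) ^ K * (4 * ((k * d : ℕ) : ℝ)) ≤ 1 := by
    have h : (4 * ((k * d : ℕ) : ℝ)) ≤ 2 ^ K := by exact_mod_cast hkd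
    calc (1 / 2 : ℝ) ^ K * (4 * ((k * d : ℕ) : ℝ)) ≤ (1 / 2 : ℝ) ^ K * 2 ^ K := by gcongr
      _ = 1 := by rw [← mul_pow]; norm_num
  have hKle : (1 / 2 : ℝ) ^ K ≤ 1 / 4 := by
    calc (1 / 2 : ℝ) ^ K ≤ (1 / 2 : ℝ) ^ 2 :=
          pow_le_pow_of_le_one (by norm_num) (by norm_num) hK2
      _ = _ := by norm_num
  have hpos : (0 : ℝ) < (1 / 2 : ℝ) ^ K := by positivity
  -- The choice `x = 2 * 2 ^ (-K)` works: by Bernoulli `(1 - x) ^ (k d) ≥ 1 - 2 k d 2 ^ (-K) ≥ 1 /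
  -- 2`, and `K ≥ 2` gives `1 - x ≥ 1 / 2`.
  have hbern := one_add_mul_le_pow (a := -(2 * (1 / 2 : ℝ) ^ K)) (by linarith) (k * d)
  have hstep := card_partialSol_insert_ge (G := G) (A := A) (K := K) (Δ := k * d)
    (x := 2 * (1 / 2 : ℝ) ^ K) (by positivity) (by linarith) (by
      rw [sub_eq_add_neg]
      nlinarith) hG hK (by
      intro j hj
      calc (A.filter fun i => ∃ l ∈ G j, ∃ l' ∈ G i, l'.1 = l.1).card
          ≤ ((G j).biUnion fun l => Finset.univ.filter fun i => ∃ l' ∈ G i, l'.1 = l.1).card := by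
            refine Finset.card_le_card ?_
            intro i hi
            obtain ⟨l, hl, h⟩ := (Finset.mem_filter.1 hi).2
            exact Finset.mem_biUnion.2 ⟨l, hl, Finset.mem_filter.2 ⟨Finset.mem_univ _, h⟩⟩
        _ ≤ (G j).card * d := Finset.card_biUnion_le_card_mul _ _ _ fun l hl => hd j l hl
        _ ≤ k * d := Nat.mul_le_mul_right _ (hk j hj)) (A₂.card)
  have h := pow_mul_card_partialSol_le (by linarith) hstep (A₂ \ A₁)
    (Finset.sdiff_subset.trans h2) A₁ (h12.trans h2) Finset.disjoint_sdiff (by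
      rw [Finset.union_sdiff_of_subset h12])
  rw [Finset.union_sdiff_of_subset h12] at h
  refine le_trans ?_ h
  have : (1 / 2 : ℝ) ≤ 1 - 2 * (1 / 2 : ℝ) ^ K := by linarith
  gcongr

end LocalLemma

/-! ### Peelable families and single flips. -/

section Peeling

variable {V J : Type*}

/-- Every nonempty subset of `S` has a clause with a variable that occurs in no other clause of
the subset. -/
def Peelable (F : J → Finset (V × Bool)) (S : Finset J) : Prop :=
  ∀ T ⊆ S, T.Nonempty → ∃ j ∈ T, ∃ l ∈ F j, ∀ i ∈ T, (∃ l' ∈ F i, l'.1 = l.1) → i = j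

/-- The solutions of a peelable family are connected by flips of single variables. -/
theorem Peelable.linked [Fintype V] {F : J → Finset (V × Bool)} {S : Finset J}
    (h : Peelable F S) : (∃ σ, FamilySat (fun j : S => F j) σ) ∧
      ∀ σ τ, FamilySat (fun j : S => F j) σ → FamilySat (fun j : S => F j) τ →
        Linked (fun j : S => F j) 1 σ τ := by
  classical
  induction S using Finset.strongInduction with
  | H S ih =>
    rcases S.eq_empty_or_nonempty with rfl | hne
    · have hsat : ∀ σ, FamilySat (fun j : (∅ : Finset J) => F j) σ := fun σ j =>
        absurd j.2 (Finset.notMem_empty _)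
      refine ⟨⟨fun _ => true, hsat _⟩, fun σ τ _ _ => ?_⟩
      have key : ∀ (s : Finset V) (σ : V → Bool), (∀ v, σ v ≠ τ v → v ∈ s) →
          Linked (fun j : (∅ : Finset J) => F j) 1 σ τ := by
        intro s
        induction s using Finset.induction_on with
        | empty =>
          intro σ hσ
          have : σ = τ := by
            funext v
            by_contra hv
            exact absurd (hσ v hv) (Finset.notMem_empty _)
          rw [this]
          exact Relation.ReflTransGen.refl
        | insert v s _ ihs =>
          intro σ hσ
          refine Relation.ReflTransGen.head (b := Function.update σ v (τ v))
            ⟨hsat _, hsat _, ?_⟩ (ihs _ ?_)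
          · exact_mod_cast Finset.card_le_one.2 (by
              intro a ha b hb
              have h1 : ∀ x, σ x ≠ Function.update σ v (τ v) x → x = v := by
                intro x hx
                by_contra hxv
                exact hx (Function.update_of_ne hxv _ _).symm
              rw [h1 a (Finset.mem_filter.1 ha).2, h1 b (Finset.mem_filter.1 hb).2])
          · intro x hx
            by_cases hxv : x = v
            · subst hxv
              simp at hx
            · rw [Function.update_of_ne hxv] at hx
              exact (Finset.mem_insert.1 (hσ x hx)).resolve_left hxv
      exact key Finset.univ σ fun v _ => Finset.mem_univ v
    · obtain ⟨j, hj, l, hl, huniq⟩ := h S subset_rfl hne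
      obtain ⟨⟨σ₀, hσ₀⟩, hlink⟩ := ih (S.erase j) (Finset.erase_ssubset hj)
        (fun T hT => h T (hT.trans (Finset.erase_subset _ _)))
      -- The variable of `l` occurs in no other clause of `S`, so making `l` true satisfies clause
      -- `j` without disturbing the rest. Thus `f` lifts paths for `S.erase j` to paths for `S`, and
      -- reaching `f σ` from `σ` costs at most one flip.
      let f : (V → Bool) → (V → Bool) := fun σ => Function.update σ l.1 l.2
      have hf : ∀ σ, FamilySat (fun j : S.erase j => F j) σ → FamilySat (fun j : S => F j) (f σ) := by
        intro σ hσ i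
        by_cases hij : i.1 = j
        · exact ⟨l, by simpa only [hij] using hl, Function.update_self _ _ _⟩
        · obtain ⟨a, ha, ha'⟩ := hσ ⟨i.1, Finset.mem_erase.2 ⟨hij, i.2⟩⟩
          refine ⟨a, ha, ?_⟩
          have : a.1 ≠ l.1 := fun hal => hij (huniq i.1 i.2 ⟨a, ha, hal⟩)
          rw [← ha']
          exact Function.update_of_ne this _ _
      have hrestrict : ∀ σ, FamilySat (fun j : S => F j) σ →
          FamilySat (fun j : S.erase j => F j) σ := fun σ hσ i =>
        hσ ⟨i.1, Finset.mem_of_mem_erase i.2⟩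
      have hstep : ∀ σ, FamilySat (fun j : S => F j) σ →
          SolStep (fun j : S => F j) 1 σ (f σ) := by
        intro σ hσ
        refine ⟨hσ, hf σ (hrestrict σ hσ), ?_⟩
        exact_mod_cast Finset.card_le_one.2 (by
          intro a ha b hb
          have h1 : ∀ x, σ x ≠ f σ x → x = l.1 := by
            intro x hx
            by_contra hxv
            exact hx (Function.update_of_ne hxv _ _).symm
          rw [h1 a (Finset.mem_filter.1 ha).2, h1 b (Finset.mem_filter.1 hb).2])
      refine ⟨⟨f σ₀, hf _ hσ₀⟩, fun σ τ hσ hτ => ?_⟩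
      have h1 := (hlink σ τ (hrestrict σ hσ) (hrestrict τ hτ)).map f hf (by
        intro a b
        refine Finset.card_le_card ?_
        intro v hv
        have hv := (Finset.mem_filter.1 hv).2
        refine Finset.mem_filter.2 ⟨Finset.mem_univ _, ?_⟩
        by_cases hvl : v = l.1
        · subst hvl
          simp [f] at hv
        · simpa [f, hvl] using hv)
      exact (Relation.ReflTransGen.head (hstep σ hσ) h1).tail (hstep τ hτ).symm

end Peeling

/-! ### Gluing the large classes of the fibres. -/

section GiantComponent

variable {V J : Type*} [Fintype V] [Fintype J]

open scoped Classical in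
theorem fiberSol_eq_partialSol (F : J → Finset (V × Bool)) (B : Finset V) (τ : V → Bool) :
    fiberSol F B τ = partialSol (fun j => (F j).filter fun l => l.1 ∉ B)
      (Finset.univ.filter fun j => Active F B τ j) := by
  ext ρ
  rw [mem_fiberSol, mem_partialSol, familySat_mix]
  refine forall_congr' fun j => ?_
  simp only [Finset.mem_filter, Finset.mem_univ, true_and, and_assoc]

open scoped Classical in
/-- The number of clauses with a variable on which `τ` and `τ'` differ. -/
theorem card_filter_ne_le (F : J → Finset (V × Bool)) {Δ : ℕ} (hΔ : ∀ v, occCount F v ≤ Δ)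
    (τ τ' : V → Bool) :
    (Finset.univ.filter fun j => ∃ l ∈ F j, τ l.1 ≠ τ' l.1).card ≤ hammingDist τ τ' * Δ := by
  calc (Finset.univ.filter fun j => ∃ l ∈ F j, τ l.1 ≠ τ' l.1).card
      ≤ ((Finset.univ.filter fun v => τ v ≠ τ' v).biUnion fun v =>
          Finset.univ.filter fun j => ∃ l ∈ F j, l.1 = v).card := by
        refine Finset.card_le_card ?_
        intro j hj
        obtain ⟨l, hl, h⟩ := (Finset.mem_filter.1 hj).2
        exact Finset.mem_biUnion.2 ⟨l.1, Finset.mem_filter.2 ⟨Finset.mem_univ _, h⟩,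
          Finset.mem_filter.2 ⟨Finset.mem_univ _, l, hl, rfl⟩⟩
    _ ≤ (Finset.univ.filter fun v => τ v ≠ τ' v).card * Δ :=
        Finset.card_biUnion_le_card_mul _ _ _ fun v _ => hΔ v
    _ = hammingDist τ τ' * Δ := by
        unfold hammingDist
        congr!

open scoped Classical in
/-- Two adjacent fibers have many common solutions. -/
theorem half_pow_mul_card_fiberSol_le {F : J → Finset (V × Bool)} {k d Δ : ℕ}
    (hF : ∀ j, IsKClause k (F j)) {B : Finset V} (hd : ∀ v ∉ B, occCount F v ≤ d)
    (hΔ : ∀ v, occCount F v ≤ Δ) (hk : 5 ≤ k) (hkd : 4 * (k * d) ≤ 2 ^ (k - 3))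
    {τ τ' : V → Bool} (hB : ∀ j, Active F B τ j → (boundVars F B j).card ≤ 3)
    (hB' : ∀ j, Active F B τ' j → (boundVars F B j).card ≤ 3) (hττ' : hammingDist τ τ' ≤ 1) :
    (1 / 2 : ℝ) ^ Δ * ((fiberSol F B τ).card : ℝ) ≤
      ((fiberSol F B τ ∩ fiberSol F B τ').card : ℝ) := by
  set G : J → Finset (V × Bool) := fun j => (F j).filter fun l => l.1 ∉ B with hG
  set A₁ : Finset J := Finset.univ.filter fun j => Active F B τ j with hA₁
  set A₂ : Finset J := Finset.univ.filter fun j => Active F B τ' j with hA₂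
  have hinter : fiberSol F B τ ∩ fiberSol F B τ' = partialSol G (A₁ ∪ A₂) := by
    ext ρ
    rw [Finset.mem_inter, fiberSol_eq_partialSol, fiberSol_eq_partialSol, mem_partialSol,
      mem_partialSol, mem_partialSol]
    simp only [Finset.mem_union, or_imp, forall_and, hA₁, hA₂, hG]
  -- A clause active for `τ'` but not for `τ` contains a variable on which they differ; there is at
  -- most one such variable, of degree at most `Δ`.
  have hcard : ((A₁ ∪ A₂) \ A₁).card ≤ Δ := by
    calc ((A₁ ∪ A₂) \ A₁).card
        ≤ (Finset.univ.filter fun j => ∃ l ∈ F j, τ l.1 ≠ τ' l.1).card := by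
          refine Finset.card_le_card ?_
          intro j hj
          rw [Finset.mem_sdiff, Finset.mem_union, hA₁, hA₂, Finset.mem_filter,
            Finset.mem_filter] at hj
          refine Finset.mem_filter.2 ⟨Finset.mem_univ _, ?_⟩
          by_contra! hcon
          have h2 := (hj.1.resolve_left hj.2).2
          refine hj.2 ⟨Finset.mem_univ _, fun l hl hlB => ?_⟩
          rw [hcon l hl]
          exact h2 l hl hlB
      _ ≤ hammingDist τ τ' * Δ := card_filter_ne_le F hΔ τ τ'
      _ ≤ 1 * Δ := Nat.mul_le_mul_right _ hττ'
      _ = Δ := one_mul _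
  have hb3 : ∀ j ∈ A₁ ∪ A₂, (boundVars F B j).card ≤ 3 := by
    intro j hj
    rcases Finset.mem_union.1 hj with h | h
    · exact hB j (Finset.mem_filter.1 h).2
    · exact hB' j (Finset.mem_filter.1 h).2
  have hmain := half_pow_mul_card_partialSol_le (G := G) (A := A₁ ∪ A₂) (K := k - 3) (k := k)
    (d := d) (by omega) hkd
    (fun j _ l hl l' hl' => (hF j).2 l (Finset.mem_filter.1 hl).1 l' (Finset.mem_filter.1 hl').1)
    (by
      intro j hj
      have h1 := Finset.card_filter_add_card_filter_not (s := F j) (fun l => l.1 ∈ B)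
      rw [(hF j).1] at h1
      have h2 : ((F j).filter fun l => l.1 ∈ B).card ≤ (boundVars F B j).card := by
        refine Finset.card_le_card_of_injOn Prod.fst ?_ ?_
        · intro l hl
          have hl := Finset.mem_filter.1 hl
          exact Finset.mem_filter.2 ⟨hl.2, l, hl.1, rfl⟩
        · intro l hl l' hl' h
          exact (hF j).2 l (Finset.mem_filter.1 hl).1 l' (Finset.mem_filter.1 hl').1 h
      have h3 := hb3 j hj
      have h4 : (G j).card = ((F j).filter fun l => ¬ l.1 ∈ B).card := rfl
      omega)
    (fun j _ => (Finset.card_filter_le _ _).trans (hF j).1.le)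
    (by
      intro j l hl
      refine le_trans ?_ (hd l.1 (Finset.mem_filter.1 hl).2)
      refine Finset.card_le_card ?_
      intro i hi
      obtain ⟨l', hl', h⟩ := (Finset.mem_filter.1 hi).2
      exact Finset.mem_filter.2 ⟨Finset.mem_univ _, l', (Finset.mem_filter.1 hl').1, h⟩)
    (A₁ := A₁) (A₂ := A₁ ∪ A₂) Finset.subset_union_left subset_rfl
  rw [hinter, fiberSol_eq_partialSol]
  refine le_trans ?_ hmain
  gcongr ?_ * _
  exact pow_le_pow_of_le_one (by norm_num) (by norm_num) hcard

open scoped Classical in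
/-- If every clause has at most three variables in `B` or lies over `B`, the clauses over `B` are
peelable, and the variables off `B` have small degree, then all but a small fraction of the
solutions are linked to one of them. -/
theorem exists_giant_linked_class {F : J → Finset (V × Bool)} {k d Δ M : ℕ} {D : ℝ}
    (hF : ∀ j, IsKClause k (F j)) {B : Finset V} (hd1 : 1 ≤ d)
    (hd : ∀ v ∉ B, occCount F v ≤ d) (hΔ : ∀ v, occCount F v ≤ Δ)
    (hk : 5 ≤ k) (hkd : 4 * (k * d) ≤ 2 ^ (k - 3))
    (hgood : ∀ j, (boundVars F B j).card ≤ 3 ∨ ∀ l ∈ F j, l.1 ∈ B)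
    (hpeel : Peelable F (Finset.univ.filter fun j => ∀ l ∈ F j, l.1 ∈ B))
    (hM : 2 * 2 ^ Δ < M) (hD : 1 ≤ D)
    (H : ∀ (m : ℕ) (Φ : KCNF k (M * (Fintype.card V * (Fintype.card J + 1))) m),
      Φ.IsBoundedDegree (8 * d) → Φ.RandomPairConnected D (1 / 2)) :
    ∃ σ, FamilySat F σ ∧ (1 - 1 / (M : ℝ)) * ((solSet F).card : ℝ) ≤
      (((solSet F).filter fun τ => Linked F D σ τ).card : ℝ) := by
  have hMpos : 1 ≤ M := by
    have : 0 < 2 ^ Δ := by positivity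
    omega
  have hMr : (0 : ℝ) < M := by exact_mod_cast hMpos
  set S : Finset J := Finset.univ.filter fun j => ∀ l ∈ F j, l.1 ∈ B with hS
  obtain ⟨⟨τ₀, hτ₀⟩, hlink⟩ := hpeel.linked
  have hact : ∀ τ, FamilySat (fun j : S => F j) τ →
      ∀ j, Active F B τ j → (boundVars F B j).card ≤ 3 := by
    intro τ hτ j hj
    refine (hgood j).resolve_right fun hjB => ?_
    obtain ⟨l, hl, hl'⟩ := hτ ⟨j, Finset.mem_filter.2 ⟨Finset.mem_univ _, hjB⟩⟩
    exact hj l hl (hjB l hl) hl'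
  have hex : ∀ τ, ∃ ρ, FamilySat (fun j : S => F j) τ → ρ ∈ fiberSol F B τ ∧
      (1 - 1 / (M : ℝ)) * ((fiberSol F B τ).card : ℝ) ≤
      (((fiberSol F B τ).filter fun ρ' => Linked F D (mix B τ ρ) (mix B τ ρ')).card : ℝ) := by
    intro τ
    by_cases hτ : FamilySat (fun j : S => F j) τ
    · obtain ⟨ρ, h1, h2⟩ := exists_large_linked_fiber (D := D) hMpos F hF B τ hd1 hd (hact τ hτ) H
      exact ⟨ρ, fun _ => ⟨h1, h2⟩⟩
    -- Arbitrary value: the fibre is empty here.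
    · exact ⟨τ, fun h => absurd h hτ⟩
  choose ρ hρ using hex
  have hadj : ∀ τ τ', SolStep (fun j : S => F j) 1 τ τ' →
      Linked F D (mix B τ (ρ τ)) (mix B τ' (ρ τ')) := by
    rintro τ τ' ⟨hτ, hτ', hdist⟩
    have hdist : hammingDist τ τ' ≤ 1 := by exact_mod_cast hdist
    obtain ⟨h1, h2⟩ := hρ τ hτ
    obtain ⟨h1', h2'⟩ := hρ τ' hτ'
    have h3 := half_pow_mul_card_fiberSol_le hF hd hΔ hk hkd (hact τ hτ) (hact τ' hτ') hdist
    have h3' := half_pow_mul_card_fiberSol_le hF hd hΔ hk hkd (hact τ' hτ') (hact τ hτ)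
      (by rwa [hammingDist_comm])
    rw [Finset.inter_comm] at h3'
    set I := fiberSol F B τ ∩ fiberSol F B τ' with hI
    -- At most `|X| / M` points of `X` fail `p`, while `|I| ≥ 2 ^ (-Δ) |X| > 2 |X| / M`. So `p`
    -- holds on more than half of `I`.
    have hneg : ∀ (X : Finset (V → Bool)) (p : (V → Bool) → Prop), I ⊆ X → X.Nonempty →
        (1 / 2 : ℝ) ^ Δ * (X.card : ℝ) ≤ (I.card : ℝ) →
        (1 - 1 / (M : ℝ)) * (X.card : ℝ) ≤ ((X.filter p).card : ℝ) →
        (I.card : ℝ) < 2 * ((I.filter p).card : ℝ) := by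
      intro X p hIX hXne hXI hXp
      have hX0 : (0 : ℝ) < X.card := by exact_mod_cast hXne.card_pos
      have e1 : ((X.filter p).card : ℝ) + (X.filter fun a => ¬ p a).card = X.card := by
        exact_mod_cast Finset.card_filter_add_card_filter_not (s := X) p
      have e2 : ((I.filter p).card : ℝ) + (I.filter fun a => ¬ p a).card = I.card := by
        exact_mod_cast Finset.card_filter_add_card_filter_not (s := I) p
      have e3 : ((I.filter fun a => ¬ p a).card : ℝ) ≤ (X.filter fun a => ¬ p a).card := by
        exact_mod_cast Finset.card_le_card (Finset.filter_subset_filter _ hIX)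
      have e4 : 2 * (1 / (M : ℝ) * X.card) < I.card := by
        refine lt_of_lt_of_le ?_ hXI
        have : 2 * (1 / (M : ℝ)) < (1 / 2 : ℝ) ^ Δ := by
          have hM' : (2 : ℝ) * 2 ^ Δ < M := by exact_mod_cast hM
          rw [one_div_pow, mul_one_div, div_lt_div_iff₀ hMr (by positivity)]
          linarith
        nlinarith
      linarith
    have hA := hneg _ (fun ρ' => Linked F D (mix B τ (ρ τ)) (mix B τ ρ'))
      Finset.inter_subset_left ⟨_, h1⟩ h3 h2
    have hA' := hneg _ (fun ρ' => Linked F D (mix B τ' (ρ τ')) (mix B τ' ρ'))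
      Finset.inter_subset_right ⟨_, h1'⟩ h3' h2'
    -- Two strict majorities of `I` intersect.
    obtain ⟨ρ', hρ'⟩ : ((I.filter fun ρ' => Linked F D (mix B τ (ρ τ)) (mix B τ ρ')) ∩
        (I.filter fun ρ' => Linked F D (mix B τ' (ρ τ')) (mix B τ' ρ'))).Nonempty := by
      rw [← Finset.card_pos]
      have e1 := Finset.card_union_add_card_inter
        (I.filter fun ρ' => Linked F D (mix B τ (ρ τ)) (mix B τ ρ'))
        (I.filter fun ρ' => Linked F D (mix B τ' (ρ τ')) (mix B τ' ρ'))
      have e2 : ((I.filter fun ρ' => Linked F D (mix B τ (ρ τ)) (mix B τ ρ')) ∪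
        (I.filter fun ρ' => Linked F D (mix B τ' (ρ τ')) (mix B τ' ρ'))).card ≤ I.card :=
        Finset.card_le_card (Finset.union_subset (Finset.filter_subset _ _)
          (Finset.filter_subset _ _))
      have hA : I.card < 2 * (I.filter fun ρ' => Linked F D (mix B τ (ρ τ)) (mix B τ ρ')).card := by
        exact_mod_cast hA
      have hA' : I.card <
          2 * (I.filter fun ρ' => Linked F D (mix B τ' (ρ τ')) (mix B τ' ρ')).card := by
        exact_mod_cast hA'
      omega
    rw [Finset.mem_inter, Finset.mem_filter, Finset.mem_filter, hI, Finset.mem_inter,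
      mem_fiberSol, mem_fiberSol] at hρ'
    obtain ⟨⟨⟨hs, hs'⟩, hl⟩, _, hl'⟩ := hρ'
    refine (hl.tail ⟨hs, hs', ?_⟩).trans hl'.symm
    exact le_trans (by exact_mod_cast (hammingDist_mix_le B τ τ' ρ').trans hdist) hD
  have hall : ∀ τ, FamilySat (fun j : S => F j) τ →
      Linked F D (mix B τ₀ (ρ τ₀)) (mix B τ (ρ τ)) := by
    intro τ hτ
    have h := hlink τ₀ τ hτ₀ hτ
    clear hτ
    induction h with
    | refl => exact Relation.ReflTransGen.refl
    | tail _ h ih => exact ih.trans (hadj _ _ h)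
  refine ⟨mix B τ₀ (ρ τ₀), mem_fiberSol.1 (hρ τ₀ hτ₀).1, ?_⟩
  set σ₀ := mix B τ₀ (ρ τ₀) with hσ₀
  have hfib : ∀ τ, (1 - 1 / (M : ℝ)) * ((fiberSol F B τ).card : ℝ) ≤
      (((fiberSol F B τ).filter fun ρ' => Linked F D σ₀ (mix B τ ρ')).card : ℝ) := by
    intro τ
    by_cases hτ : FamilySat (fun j : S => F j) τ
    · refine (hρ τ hτ).2.trans ?_
      rw [Nat.cast_le]
      refine Finset.card_le_card fun ρ' hρ' => ?_
      rw [Finset.mem_filter] at hρ' ⊢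
      exact ⟨hρ'.1, (hall τ hτ).trans hρ'.2⟩
    · have : fiberSol F B τ = ∅ := by
        rw [Finset.eq_empty_iff_forall_notMem]
        intro ρ' hρ'
        refine hτ fun j => ?_
        obtain ⟨l, hl, hl'⟩ := (mem_fiberSol.1 hρ') j.1
        have hlB : l.1 ∈ B := (Finset.mem_filter.1 j.2).2 l hl
        refine ⟨l, hl, ?_⟩
        simpa [mix, hlB] using hl'
      simp [this]
  have hsum : ∀ (T : Finset (V → Bool)) (R : (V → Bool) → Finset (V → Bool)),
      (∀ τ ρ', ρ' ∈ R τ ↔ mix B τ ρ' ∈ T) →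
      ∑ τ, ((R τ).card : ℝ) = (T.card : ℝ) * (Fintype.card (V → Bool) : ℝ) := by
    intro T R hR
    exact_mod_cast sum_card_fiber_mix B T R hR
  have hpos : (0 : ℝ) < (Fintype.card (V → Bool) : ℝ) := by exact_mod_cast Fintype.card_pos
  refine le_of_mul_le_mul_right ?_ hpos
  rw [mul_assoc, ← hsum (solSet F) (fiberSol F B) fun τ ρ' => by rw [mem_fiberSol, mem_solSet],
    ← hsum ((solSet F).filter fun τ => Linked F D σ₀ τ)
      (fun τ => (fiberSol F B τ).filter fun ρ' => Linked F D σ₀ (mix B τ ρ')) fun τ ρ' => by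
        rw [Finset.mem_filter, Finset.mem_filter, mem_fiberSol, mem_solSet], Finset.mul_sum]
  exact Finset.sum_le_sum fun τ _ => hfib τ

end GiantComponent

/-! ### Expansion, and closing up the high-degree variables. -/

section Closure

variable {V J : Type*}

open scoped Classical in
/-- The variables that occur in a clause. -/
noncomputable def clauseVars (C : Finset (V × Bool)) : Finset V := C.image Prod.fst

open scoped Classical in
/-- The variables that occur in the clauses with indices in `S`. -/
noncomputable def varSet (F : J → Finset (V × Bool)) (S : Finset J) : Finset V :=
  S.biUnion fun j => clauseVars (F j)

theorem mem_clauseVars {C : Finset (V × Bool)} {v : V} :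
    v ∈ clauseVars C ↔ ∃ l ∈ C, l.1 = v := by
  simp only [clauseVars, Finset.mem_image]

theorem mem_varSet {F : J → Finset (V × Bool)} {S : Finset J} {v : V} :
    v ∈ varSet F S ↔ ∃ j ∈ S, v ∈ clauseVars (F j) := by
  simp only [varSet, Finset.mem_biUnion]

theorem IsKClause.card_clauseVars {k : ℕ} {C : Finset (V × Bool)} (h : IsKClause k C) :
    (clauseVars C).card = k := by
  classical
  rw [clauseVars, Finset.card_image_of_injOn (fun a ha b hb hab => h.2 a ha b hb hab), h.1]

/-- Sets of clauses that span many variables are peelable. -/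
theorem peelable_of_expansion {F : J → Finset (V × Bool)} {k : ℕ} (hF : ∀ j, IsKClause k (F j))
    {S : Finset J} (h : ∀ T ⊆ S, T.Nonempty → k * T.card < 2 * (varSet F T).card) :
    Peelable F S := by
  classical
  intro T hT hne
  by_contra! hcon
  -- Double counting: if no clause of `T` has a private variable, each variable lies in at least two
  -- clauses, so `2 |varSet F T| ≤ k |T|`.
  have := Finset.card_mul_le_card_mul (s := varSet F T) (t := T) (m := 2) (n := k)
    (fun v j => v ∈ clauseVars (F j)) (by
      intro v hv
      obtain ⟨j, hj, hvj⟩ := mem_varSet.1 hv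
      obtain ⟨l, hl, rfl⟩ := mem_clauseVars.1 hvj
      obtain ⟨i, hi, hil, hij⟩ := hcon j hj l hl
      exact Finset.one_lt_card.2 ⟨i, Finset.mem_filter.2 ⟨hi, mem_clauseVars.2 hil⟩, j,
        Finset.mem_filter.2 ⟨hj, hvj⟩, hij⟩)
    (by
      intro j _
      rw [← (hF j).card_clauseVars]
      exact Finset.card_le_card fun v hv => (Finset.mem_filter.1 hv).2)
  have h2 := h T hT hne
  rw [mul_comm k, mul_comm 2] at h2
  omega

theorem boundVars_card [Fintype V] (F : J → Finset (V × Bool)) (B : Finset V) (j : J)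
    [DecidableEq V] : (boundVars F B j).card = (B ∩ clauseVars (F j)).card := by
  congr 1
  ext v
  rw [mem_boundVars, Finset.mem_inter, mem_clauseVars]

open scoped Classical in
/-- In a formula in which small sets of clauses expand, a small set `B₀` of variables is contained
in a set `B` such that every clause has at most three variables in `B` or lies over `B`, and the
clauses over `B` are peelable. -/
theorem exists_closure [Fintype V] [Fintype J] {F : J → Finset (V × Bool)} {k b : ℕ}
    (hk : 6 ≤ k) (hb : 1 ≤ b) (hF : ∀ j, IsKClause k (F j)) (B₀ : Finset V) (hB₀ : B₀.card ≤ b)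
    (hexp : ∀ S : Finset J, S.Nonempty → S.card ≤ b → (k - 3) * S.card < (varSet F S).card) :
    ∃ B : Finset V, B₀ ⊆ B ∧ (∀ j, (boundVars F B j).card ≤ 3 ∨ ∀ l ∈ F j, l.1 ∈ B) ∧
      Peelable F (Finset.univ.filter fun j => ∀ l ∈ F j, l.1 ∈ B) := by
  -- `S` is a largest set of at most `b` clauses that adds at most `k - 4` new variables per clause
  -- to `B₀`. A further clause with four variables already present would preserve this bound, so
  -- maximality forbids it as long as `|S| < b`.
  obtain ⟨S, hS, hmax⟩ := Finset.exists_max_image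
    ((Finset.univ : Finset (Finset J)).filter fun S => S.card ≤ b ∧
      (B₀ ∪ varSet F S).card ≤ B₀.card + (k - 4) * S.card) Finset.card
    ⟨∅, Finset.mem_filter.2 ⟨Finset.mem_univ _, by simp, by simp [varSet]⟩⟩
  simp only [Finset.mem_filter, Finset.mem_univ, true_and] at hS hmax
  -- If `|S| = b`, expansion gives more than `(k - 3) b` variables, but there are at most `|B₀| + (k
  -- - 4) b ≤ (k - 3) b`.
  have hlt : S.card < b := by
    refine lt_of_le_of_ne hS.1 fun h => ?_
    have h1 := hexp S (Finset.card_pos.1 (by omega)) hS.1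
    have h2 : (varSet F S).card ≤ (B₀ ∪ varSet F S).card :=
      Finset.card_le_card Finset.subset_union_right
    have h3 : k - 3 = (k - 4) + 1 := by omega
    rw [h3, add_mul, h, one_mul] at h1
    rw [h] at hS
    omega
  have hout : ∀ j ∉ S, (boundVars F (B₀ ∪ varSet F S) j).card ≤ 3 := by
    intro j hj
    by_contra! hcon
    rw [boundVars_card] at hcon
    have h1 := hmax (insert j S) (by
      rw [Finset.card_insert_of_notMem hj]
      refine ⟨by omega, ?_⟩
      have h2 : B₀ ∪ varSet F (insert j S) = (B₀ ∪ varSet F S) ∪ clauseVars (F j) := by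
        rw [varSet, Finset.biUnion_insert, Finset.union_assoc,
          Finset.union_comm (clauseVars (F j))]
        rfl
      have h3 := Finset.card_union_add_card_inter (B₀ ∪ varSet F S) (clauseVars (F j))
      rw [(hF j).card_clauseVars] at h3
      rw [h2, mul_add]
      omega)
    rw [Finset.card_insert_of_notMem hj] at h1
    omega
  refine ⟨B₀ ∪ varSet F S, Finset.subset_union_left, fun j => ?_, ?_⟩
  · by_cases hj : j ∈ S
    · exact Or.inr fun l hl => Finset.mem_union_right _
        (mem_varSet.2 ⟨j, hj, mem_clauseVars.2 ⟨l, hl, rfl⟩⟩)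
    · exact Or.inl (hout j hj)
  · have hsub : (Finset.univ.filter fun j => ∀ l ∈ F j, l.1 ∈ B₀ ∪ varSet F S) ⊆ S := by
      intro j hj
      by_contra hjS
      have h1 := hout j hjS
      have h2 : clauseVars (F j) ⊆ B₀ ∪ varSet F S := by
        intro v hv
        obtain ⟨l, hl, rfl⟩ := mem_clauseVars.1 hv
        exact (Finset.mem_filter.1 hj).2 l hl
      rw [boundVars_card, Finset.inter_eq_right.2 h2, (hF j).card_clauseVars] at h1
      omega
    refine peelable_of_expansion hF fun T hT hne => ?_
    have h1 := hexp T hne ((Finset.card_le_card (hT.trans hsub)).trans hlt.le)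
    have h2 : k * T.card ≤ 2 * ((k - 3) * T.card) := by
      rw [← mul_assoc]
      exact Nat.mul_le_mul_right _ (by omega)
    omega

end Closure

/-! ### From a large class to both conclusions. -/

namespace KCNF

variable {k n m : ℕ}

open scoped Classical in
/-- A large class of pairwise linked solutions gives connected random pairs and a giant
component. -/
theorem connected_of_large_class {Φ : KCNF k n m} {D ε δ : ℝ} (hδ : 2 * δ ≤ ε) (hδ0 : 0 ≤ δ)
    (hδ1 : δ ≤ 1) {σ : Assignment n} (hσ : FamilySat (fun j => (Φ j).1) σ)
    (h : (1 - δ) * ((solSet fun j => (Φ j).1).card : ℝ) ≤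
      (((solSet fun j => (Φ j).1).filter fun τ => Linked (fun j => (Φ j).1) D σ τ).card : ℝ)) :
    Φ.RandomPairConnected D ε ∧ Φ.HasGiantComponent D ε := by
  have hsol : (solSet fun j => (Φ j).1) = Φ.solutions := by
    ext τ; rw [mem_solSet, mem_solutions]
  rw [hsol] at h
  have hσ' : σ ∈ Φ.solutions := (mem_solutions _ _).2 hσ
  set S := Φ.solutions.filter fun τ => Linked (fun j => (Φ j).1) D σ τ with hS
  have hpair : ∀ τ ∈ S, ∀ υ ∈ S, Φ.DConnected D τ υ := by
    intro τ hτ υ hυ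
    rw [hS, Finset.mem_filter, mem_solutions] at hτ hυ
    exact dConnected_of_linked hτ.1 (hτ.2.symm.trans hυ.2)
  have hpos : (0 : ℝ) < (Φ.solutions.card : ℝ) := by
    exact_mod_cast Finset.card_pos.2 ⟨σ, hσ'⟩
  refine ⟨⟨⟨σ, hσ'⟩, ?_⟩, S, ⟨⟨σ, ?_⟩, Finset.filter_subset _ _, hpair, ?_⟩, ?_⟩
  · rw [uniformProb, Finset.card_product, le_div_iff₀ (by push_cast; positivity)]
    have h1 : S.card * S.card ≤
        ((Φ.solutions ×ˢ Φ.solutions).filter fun p => Φ.DConnected D p.1 p.2).card := by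
      rw [← Finset.card_product]
      refine Finset.card_le_card fun p hp => ?_
      rw [Finset.mem_product] at hp
      exact Finset.mem_filter.2 ⟨Finset.mem_product.2
        ⟨Finset.filter_subset _ _ hp.1, Finset.filter_subset _ _ hp.2⟩,
        hpair _ hp.1 _ hp.2⟩
    have h2 : ((S.card * S.card : ℕ) : ℝ) ≤
        (((Φ.solutions ×ˢ Φ.solutions).filter fun p => Φ.DConnected D p.1 p.2).card : ℝ) := by
      exact_mod_cast h1
    refine le_trans ?_ h2
    push_cast
    calc (1 - ε) * ((Φ.solutions.card : ℝ) * Φ.solutions.card)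
        ≤ ((1 - δ) * Φ.solutions.card) * ((1 - δ) * Φ.solutions.card) := by
          have : 1 - ε ≤ (1 - δ) * (1 - δ) := by nlinarith
          calc _ ≤ ((1 - δ) * (1 - δ)) * ((Φ.solutions.card : ℝ) * Φ.solutions.card) := by gcongr
            _ = _ := by ring
      _ ≤ (S.card : ℝ) * S.card := by
          have : 0 ≤ (1 - δ) * (Φ.solutions.card : ℝ) := mul_nonneg (by linarith) hpos.le
          gcongr
  · exact Finset.mem_filter.2 ⟨hσ', Relation.ReflTransGen.refl⟩
  · intro τ hτ υ hυ hτυ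
    exact Finset.mem_filter.2 ⟨hυ, (Finset.mem_filter.1 hτ).2.trans hτυ.linked⟩
  · refine le_trans ?_ h
    gcongr
    linarith

theorem isKClause (Φ : KCNF k n m) (j : Fin m) : IsKClause k (Φ j).1 := (Φ j).2

end KCNF

/-! ### Union bounds and binomial estimates. -/

section UniformProb

theorem uniformProb_nonneg {α : Type*} (s : Finset α) (P : α → Prop) : 0 ≤ uniformProb s P := by
  unfold uniformProb; positivity

open scoped Classical in
theorem uniformProb_le_sum {α ι : Type*} (s : Finset α) (I : Finset ι) (P : α → Prop)
    (Q : ι → α → Prop) (h : ∀ a ∈ s, P a → ∃ i ∈ I, Q i a) :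
    uniformProb s P ≤ ∑ i ∈ I, uniformProb s (Q i) := by
  unfold uniformProb
  rw [← Finset.sum_div]
  gcongr
  have : (s.filter P).card ≤ ∑ i ∈ I, (s.filter (Q i)).card := by
    refine (Finset.card_le_card ?_).trans Finset.card_biUnion_le
    intro a ha
    rw [Finset.mem_filter] at ha
    obtain ⟨i, hi, hQ⟩ := h a ha.1 ha.2
    exact Finset.mem_biUnion.2 ⟨i, hi, Finset.mem_filter.2 ⟨ha.1, hQ⟩⟩
  exact_mod_cast this

open scoped Classical in
theorem one_sub_uniformProb_le {α : Type*} {s : Finset α} (hs : s.Nonempty) (P Q : α → Prop)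
    (h : ∀ a ∈ s, ¬ Q a → P a) : 1 - uniformProb s Q ≤ uniformProb s P := by
  have hpos : (0 : ℝ) < (s.card : ℝ) := by exact_mod_cast hs.card_pos
  unfold uniformProb
  rw [sub_le_iff_le_add, ← add_div, le_div_iff₀ hpos, one_mul]
  have : s.card ≤ (s.filter P).card + (s.filter Q).card := by
    refine (Finset.card_le_card ?_).trans (Finset.card_union_le _ _)
    intro a ha
    by_cases hQ : Q a
    · exact Finset.mem_union_right _ (Finset.mem_filter.2 ⟨ha, hQ⟩)
    · exact Finset.mem_union_left _ (Finset.mem_filter.2 ⟨ha, h a ha hQ⟩)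
  exact_mod_cast this

theorem uniformProb_mono {α : Type*} {s : Finset α} {P Q : α → Prop}
    (h : ∀ a ∈ s, P a → Q a) : uniformProb s P ≤ uniformProb s Q := by
  have := uniformProb_le_sum s (Finset.univ : Finset Unit) P (fun _ => Q)
    fun a ha hP => ⟨(), Finset.mem_univ _, h a ha hP⟩
  simpa using this

/-- Factor by factor, `(w - i) / (n - i) ≤ w / n`; the form avoids division. -/
theorem choose_mul_pow_le {w n : ℕ} (h : w ≤ n) (k : ℕ) :
    w.choose k * n ^ k ≤ n.choose k * w ^ k := by
  have key : w.descFactorial k * n ^ k ≤ n.descFactorial k * w ^ k := by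
    induction k with
    | zero => simp
    | succ k ih =>
      rw [Nat.descFactorial_succ, Nat.descFactorial_succ, pow_succ, pow_succ]
      have h1 : (w - k) * n ≤ (n - k) * w := by
        rcases le_total k w with hk | hk
        · obtain ⟨a, rfl⟩ := Nat.exists_eq_add_of_le hk
          obtain ⟨c, rfl⟩ := Nat.exists_eq_add_of_le h
          rw [Nat.add_sub_cancel_left, add_assoc, Nat.add_sub_cancel_left]
          nlinarith [Nat.zero_le (k * c)]
        · simp [Nat.sub_eq_zero_of_le hk]
      calc (w - k) * w.descFactorial k * (n ^ k * n)
          = ((w - k) * n) * (w.descFactorial k * n ^ k) := by ring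
        _ ≤ ((n - k) * w) * (n.descFactorial k * w ^ k) := Nat.mul_le_mul h1 ih
        _ = _ := by ring
  rw [Nat.descFactorial_eq_factorial_mul_choose, Nat.descFactorial_eq_factorial_mul_choose,
    mul_assoc, mul_assoc] at key
  exact Nat.le_of_mul_le_mul_left key (Nat.factorial_pos k)

/-- `C(n, r) ≤ (e n / r) ^ r`. -/
theorem choose_le_exp_mul_div_pow (n : ℕ) {r : ℕ} (hr : 1 ≤ r) :
    (n.choose r : ℝ) ≤ (Real.exp 1 * n / r) ^ r := by
  have hr' : (0 : ℝ) < r := by exact_mod_cast hr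
  have h1 : (r : ℝ) ^ r / r.factorial ≤ Real.exp r := Real.pow_div_factorial_le_exp _ hr'.le r
  have hf : (0 : ℝ) < r.factorial := by exact_mod_cast Nat.factorial_pos r
  calc (n.choose r : ℝ) ≤ (n : ℝ) ^ r / r.factorial := Nat.choose_le_pow_div r n
    _ = (n : ℝ) ^ r / r ^ r * (r ^ r / r.factorial) := by field_simp
    _ ≤ (n : ℝ) ^ r / r ^ r * Real.exp r := by gcongr
    _ = (Real.exp 1 * n / r) ^ r := by
      rw [div_pow, mul_pow, ← Real.exp_nat_mul, mul_one]
      ring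

end UniformProb

/-! ### The distribution of a random clause. -/

section RandomClause

variable {k n : ℕ}

open scoped Classical in
/-- The number of clauses whose set of variables has a given property. -/
theorem card_filter_clauseVars (P : Finset (Fin n) → Prop) :
    ((Finset.univ : Finset (KClause k n)).filter fun C => P (clauseVars C.1)).card =
      ((Finset.univ.powersetCard k).filter P).card * 2 ^ k := by
  have h1 : (((Finset.univ.powersetCard k).filter P).sigma fun A => A.powerset).card =
      ((Finset.univ.powersetCard k).filter P).card * 2 ^ k := by
    rw [Finset.card_sigma]
    refine Finset.sum_const_nat fun A hA => ?_
    rw [Finset.card_powerset, (Finset.mem_powersetCard.1 (Finset.mem_filter.1 hA).1).2]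
  rw [← h1]
  symm
  -- A clause corresponds to its variable set together with the subset of variables occurring
  -- positively.
  let f : (Σ _ : Finset (Fin n), Finset (Fin n)) → Finset (Literal n) := fun x =>
    x.1.image fun v => (v, decide (v ∈ x.2))
  have hinj : ∀ (T : Finset (Fin n)), Function.Injective fun v : Fin n => (v, decide (v ∈ T)) :=
    fun T a b h => congrArg Prod.fst h
  have hvars : ∀ x, clauseVars (f x) = x.1 := by
    intro x
    ext v
    rw [mem_clauseVars]
    simp [f]
  refine Finset.card_bij (fun x hx => ⟨f x, ?_, ?_⟩) ?_ ?_ ?_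
  · rw [Finset.card_image_of_injective _ (hinj _)]
    exact (Finset.mem_powersetCard.1 (Finset.mem_filter.1 (Finset.mem_sigma.1 hx).1).1).2
  · intro l hl l' hl' h
    obtain ⟨v, _, rfl⟩ := Finset.mem_image.1 hl
    obtain ⟨v', _, rfl⟩ := Finset.mem_image.1 hl'
    dsimp only at h
    rw [h]
  · intro x hx
    refine Finset.mem_filter.2 ⟨Finset.mem_univ _, ?_⟩
    rw [hvars]
    exact (Finset.mem_filter.1 (Finset.mem_sigma.1 hx).1).2
  · rintro ⟨A, T⟩ hx ⟨A', T'⟩ hx' h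
    have h := congrArg Subtype.val h
    dsimp only at h
    have hA : A = A' := by
      have := congrArg clauseVars h
      rwa [hvars, hvars] at this
    subst hA
    have hT := Finset.mem_powerset.1 (Finset.mem_sigma.1 hx).2
    have hT' := Finset.mem_powerset.1 (Finset.mem_sigma.1 hx').2
    have key : ∀ v ∈ A, (v ∈ T ↔ v ∈ T') := by
      intro v hv
      have h2 : (v, decide (v ∈ T)) ∈ f ⟨A, T'⟩ := h ▸ Finset.mem_image.2 ⟨v, hv, rfl⟩
      obtain ⟨v', _, h3⟩ := Finset.mem_image.1 h2
      simp only [Prod.mk.injEq] at h3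
      obtain ⟨rfl, h4⟩ := h3
      simpa using h4.symm
    have : T = T' := by
      ext v
      exact ⟨fun hv => (key v (hT hv)).1 hv, fun hv => (key v (hT' hv)).2 hv⟩
    rw [this]
  · rintro ⟨C, hCk, hC⟩ hCP
    have hP := (Finset.mem_filter.1 hCP).2
    have hk : IsKClause k C := ⟨hCk, hC⟩
    have hT : (C.filter fun l => l.2 = true).image Prod.fst ⊆ clauseVars C := by
      intro v hv
      obtain ⟨l, hl, rfl⟩ := Finset.mem_image.1 hv
      exact mem_clauseVars.2 ⟨l, (Finset.mem_filter.1 hl).1, rfl⟩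
    refine ⟨⟨clauseVars C, (C.filter fun l => l.2 = true).image Prod.fst⟩,
      Finset.mem_sigma.2 ⟨Finset.mem_filter.2 ⟨Finset.mem_powersetCard.2
        ⟨Finset.subset_univ _, hk.card_clauseVars⟩, hP⟩, Finset.mem_powerset.2 hT⟩, ?_⟩
    refine Subtype.ext (Finset.eq_of_subset_of_card_le ?_ ?_).symm
    · intro l hl
      refine Finset.mem_image.2 ⟨l.1, mem_clauseVars.2 ⟨l, hl, rfl⟩, Prod.ext rfl ?_⟩
      have : l.1 ∈ (C.filter fun l => l.2 = true).image Prod.fst ↔ l.2 = true := by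
        constructor
        · intro h
          obtain ⟨l', hl', h'⟩ := Finset.mem_image.1 h
          rw [Finset.mem_filter] at hl'
          rw [← hC l' hl'.1 l hl h']
          exact hl'.2
        · intro h
          exact Finset.mem_image.2 ⟨l, Finset.mem_filter.2 ⟨hl, h⟩, rfl⟩
      dsimp only
      simp only [this, Bool.decide_eq_true]
    · rw [Finset.card_image_of_injective _ (hinj _), hk.card_clauseVars, hCk]

theorem card_kClause : (Finset.univ : Finset (KClause k n)).card = n.choose k * 2 ^ k := by
  classical
  have := card_filter_clauseVars (k := k) (n := n) fun _ => True
  simpa using this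

/-- Every variable set carries the same number `2 ^ k` of sign patterns, so only variable sets need
counting. -/
theorem uniformProb_clauseVars_le (hkn : k ≤ n) (P : Finset (Fin n) → Prop) {N : ℕ} {p : ℝ}
    (hN : ∀ S : Finset (Finset (Fin n)), (∀ A ∈ S, A.card = k ∧ P A) → S.card ≤ N)
    (hp : (N : ℝ) ≤ p * (n.choose k : ℝ)) :
    uniformProb (Finset.univ : Finset (KClause k n)) (fun C => P (clauseVars C.1)) ≤ p := by
  classical
  have hpos : (0 : ℝ) < (n.choose k : ℝ) := by exact_mod_cast Nat.choose_pos hkn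
  have h := card_filter_clauseVars (k := k) (n := n) P
  have h2 := hN ((Finset.univ.powersetCard k).filter P) fun A hA =>
    ⟨(Finset.mem_powersetCard.1 (Finset.mem_filter.1 hA).1).2, (Finset.mem_filter.1 hA).2⟩
  have h3 : (((Finset.univ.powersetCard k).filter P).card : ℝ) ≤ N := by exact_mod_cast h2
  unfold uniformProb
  rw [card_kClause, div_le_iff₀ (by push_cast; positivity)]
  calc _ = (((Finset.univ.powersetCard k).filter P).card : ℝ) * 2 ^ k := by
        rw [← Nat.cast_ofNat, ← Nat.cast_pow, ← Nat.cast_mul, ← h]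
    _ ≤ N * 2 ^ k := by gcongr
    _ ≤ (p * (n.choose k : ℝ)) * 2 ^ k := by gcongr
    _ = _ := by push_cast; ring

/-- A random clause lies over a set of `w` variables with probability at most `(w / n) ^ k`. -/
theorem uniformProb_clauseVars_subset_le (hk : 1 ≤ k) (hkn : k ≤ n) (W : Finset (Fin n)) :
    uniformProb (Finset.univ : Finset (KClause k n)) (fun C => clauseVars C.1 ⊆ W) ≤
      ((W.card : ℝ) / n) ^ k := by
  have hn : (0 : ℝ) < (n : ℝ) := by exact_mod_cast (by omega : 0 < n)
  refine uniformProb_clauseVars_le hkn (fun A => A ⊆ W) (N := W.card.choose k) ?_ ?_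
  · intro S hS
    rw [← Finset.card_powersetCard]
    exact Finset.card_le_card fun A hA => Finset.mem_powersetCard.2 ⟨(hS A hA).2, (hS A hA).1⟩
  · have h1 : W.card ≤ n := by simpa using Finset.card_le_univ W
    have h := choose_mul_pow_le h1 k
    have h' : (W.card.choose k : ℝ) * n ^ k ≤ n.choose k * (W.card : ℝ) ^ k := by exact_mod_cast h
    rw [div_pow, div_mul_eq_mul_div, le_div_iff₀ (by positivity), mul_comm (_ ^ k)]
    exact h'

/-- A random clause contains `u` given variables with probability at most `(k / n) ^ u`. -/
theorem uniformProb_subset_clauseVars_le (hk : 1 ≤ k) (hkn : k ≤ n) (U : Finset (Fin n)) :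
    uniformProb (Finset.univ : Finset (KClause k n)) (fun C => U ⊆ clauseVars C.1) ≤
      ((k : ℝ) / n) ^ U.card := by
  have hn : (0 : ℝ) < (n : ℝ) := by exact_mod_cast (by omega : 0 < n)
  have hUn : U.card ≤ n := by simpa using Finset.card_le_univ U
  by_cases hUk : U.card ≤ k
  · refine uniformProb_clauseVars_le hkn (fun A => U ⊆ A) (N := (n - U.card).choose (k - U.card))
      ?_ ?_
    · intro S hS
      have h1 : (Uᶜ).card = n - U.card := by rw [Finset.card_compl, Fintype.card_fin]
      rw [← h1, ← Finset.card_powersetCard]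
      refine Finset.card_le_card_of_injOn (fun A => A \ U) ?_ ?_
      · intro A hA
        obtain ⟨hAk, hUA⟩ := hS A hA
        refine Finset.mem_powersetCard.2 ⟨?_, by rw [Finset.card_sdiff_of_subset hUA, hAk]⟩
        intro v hv
        exact Finset.mem_compl.2 (Finset.mem_sdiff.1 hv).2
      · intro A hA A' hA' h
        dsimp only at h
        rw [← Finset.union_sdiff_of_subset (hS A hA).2, h,
          Finset.union_sdiff_of_subset (hS A' hA').2]
    -- With `u = |U|`, the probability is `C(n - u, k - u) / C(n, k) = C(k, u) / C(n, u)`, which is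
    -- at most `(k / n) ^ u`.
    · have h1 := choose_mul_pow_le hkn U.card
      have h2 := Nat.choose_mul (n := n) hUk
      have h1' : (k.choose U.card : ℝ) * n ^ U.card ≤ n.choose U.card * (k : ℝ) ^ U.card := by
        exact_mod_cast h1
      have h2' : (n.choose k : ℝ) * k.choose U.card =
          n.choose U.card * ((n - U.card).choose (k - U.card) : ℝ) := by exact_mod_cast h2
      have hc : (0 : ℝ) < n.choose U.card := by exact_mod_cast Nat.choose_pos hUn
      rw [div_pow, div_mul_eq_mul_div, le_div_iff₀ (by positivity)]
      refine le_of_mul_le_mul_left ?_ hc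
      calc (n.choose U.card : ℝ) * (((n - U.card).choose (k - U.card) : ℝ) * n ^ U.card)
          = (n.choose k : ℝ) * (k.choose U.card * n ^ U.card) := by
            rw [← mul_assoc, ← h2']; ring
        _ ≤ (n.choose k : ℝ) * (n.choose U.card * (k : ℝ) ^ U.card) := by gcongr
        _ = _ := by ring
  · refine uniformProb_clauseVars_le hkn (fun A => U ⊆ A) (N := 0) ?_
      (by rw [Nat.cast_zero]; positivity)
    intro S hS
    rw [Nat.le_zero, Finset.card_eq_zero, Finset.eq_empty_iff_forall_notMem]
    intro A hA
    have := Finset.card_le_card (hS A hA).2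
    rw [(hS A hA).1] at this
    omega

theorem nonempty_kCNF (hkn : k ≤ n) (m : ℕ) : (Finset.univ : Finset (KCNF k n m)).Nonempty := by
  have : 0 < (Finset.univ : Finset (KClause k n)).card := by
    rw [card_kClause]
    have := Nat.choose_pos hkn
    positivity
  obtain ⟨C, _⟩ := Finset.card_pos.1 this
  exact ⟨fun _ => C, Finset.mem_univ _⟩

open scoped Classical in
/-- The clauses of a random formula are independent. -/
theorem uniformProb_forall {m : ℕ} (Q : Fin m → KClause k n → Prop) :
    uniformProb (Finset.univ : Finset (KCNF k n m)) (fun Φ => ∀ j, Q j (Φ j)) =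
      ∏ j, uniformProb (Finset.univ : Finset (KClause k n)) (Q j) := by
  have h1 : ((Finset.univ : Finset (KCNF k n m)).filter fun Φ => ∀ j, Q j (Φ j)).card =
      ∏ j, ((Finset.univ : Finset (KClause k n)).filter (Q j)).card := by
    rw [← Fintype.card_piFinset]
    congr 1
    ext Φ
    rw [Fintype.mem_piFinset, Finset.mem_filter]
    simp only [Finset.mem_univ, true_and, Finset.mem_filter]
  have h2 : (Finset.univ : Finset (KCNF k n m)).card =
      ∏ _j : Fin m, (Finset.univ : Finset (KClause k n)).card := by
    rw [← Fintype.card_piFinset]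
    congr 1
    ext Φ
    rw [Fintype.mem_piFinset]
    simp only [Finset.mem_univ, implies_true]
  unfold uniformProb
  rw [h2, Finset.prod_div_distrib, ← Nat.cast_prod, ← Nat.cast_prod, ← h1]
  congr!

end RandomClause

/-! ### First-moment bounds for degrees and expansion. -/

section FirstMoment

variable {k n m : ℕ}

theorem uniformProb_le_one {α : Type*} (s : Finset α) (P : α → Prop) : uniformProb s P ≤ 1 := by
  classical
  unfold uniformProb
  refine div_le_one_of_le₀ ?_ (by positivity)
  exact_mod_cast Finset.card_le_card (Finset.filter_subset _ _)

/-- The probability that some `s` clauses span at most `w` variables. -/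
theorem uniformProb_exists_varSet_card_le (hk : 1 ≤ k) (hkn : k ≤ n) (s : ℕ) {w : ℕ} (hw : w ≤ n) :
    uniformProb (Finset.univ : Finset (KCNF k n m)) (fun Φ => ∃ S : Finset (Fin m), S.card = s ∧
      (varSet (fun j => (Φ j).1) S).card ≤ w) ≤
      m.choose s * n.choose w * ((w : ℝ) / n) ^ (k * s) := by
  classical
  refine (uniformProb_le_sum _ ((Finset.univ.powersetCard s : Finset (Finset (Fin m))) ×ˢ
    (Finset.univ.powersetCard w : Finset (Finset (Fin n)))) _
    (fun p Φ => ∀ j, j ∈ p.1 → clauseVars (Φ j).1 ⊆ p.2) ?_).trans ?_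
  · rintro Φ - ⟨S, hS, hcard⟩
    obtain ⟨W, hW, hWc⟩ := Finset.exists_superset_card_eq hcard (by simpa using hw)
    refine ⟨(S, W), ?_, fun j hj v hv => hW (mem_varSet.2 ⟨j, hj, hv⟩)⟩
    simp [hS, hWc]
  · refine (Finset.sum_le_card_nsmul _ _ (((w : ℝ) / n) ^ (k * s)) ?_).trans ?_
    · rintro ⟨S, W⟩ hp
      rw [Finset.mem_product, Finset.mem_powersetCard, Finset.mem_powersetCard] at hp
      rw [uniformProb_forall (fun j C => j ∈ S → clauseVars C.1 ⊆ W)]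
      calc _ ≤ ∏ j, (if j ∈ S then ((w : ℝ) / n) ^ k else 1) := by
            refine Finset.prod_le_prod (fun j _ => uniformProb_nonneg _ _) fun j _ => ?_
            split_ifs with hj
            · simp only [hj, true_imp_iff]
              rw [← hp.2.2]
              exact uniformProb_clauseVars_subset_le hk hkn W
            · exact uniformProb_le_one _ _
        _ = ((w : ℝ) / n) ^ (k * s) := by
            rw [Finset.prod_ite_mem, Finset.univ_inter, Finset.prod_const, hp.1.2, pow_mul]
    · rw [Finset.card_product, Finset.card_powersetCard, Finset.card_powersetCard, nsmul_eq_mul]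
      simp

/-- The probability that some `b` variables occur in at least `t` clauses each. -/
theorem uniformProb_exists_occCount_ge (hk : 1 ≤ k) (hkn : k ≤ n) (b t : ℕ) :
    uniformProb (Finset.univ : Finset (KCNF k n m)) (fun Φ => ∃ U : Finset (Fin n), U.card = b ∧
      ∀ u ∈ U, t ≤ occCount (fun j => (Φ j).1) u) ≤
      n.choose b * (m.choose t) ^ b * ((k : ℝ) / n) ^ (t * b) := by
  classical
  -- A witness gives each `u ∈ U` a set of `t` clauses containing it; the forced value `∅` off `U`
  -- keeps the count at `C(n, b) C(m, t) ^ b`.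
  let I : Finset (Σ _ : Finset (Fin n), Fin n → Finset (Fin m)) :=
    (Finset.univ.powersetCard b : Finset (Finset (Fin n))).sigma fun U =>
      Fintype.piFinset fun v => if v ∈ U then Finset.univ.powersetCard t else {∅}
  refine (uniformProb_le_sum _ I _
    (fun p Φ => ∀ j, (p.1.filter fun u => j ∈ p.2 u) ⊆ clauseVars (Φ j).1) ?_).trans ?_
  · rintro Φ - ⟨U, hU, hocc⟩
    have hex : ∀ v, ∃ T : Finset (Fin m), (T ∈ if v ∈ U then
        (Finset.univ.powersetCard t : Finset (Finset (Fin m))) else {∅}) ∧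
        ∀ j ∈ T, v ∈ clauseVars (Φ j).1 := by
      intro v
      by_cases hv : v ∈ U
      · obtain ⟨s, hs, hmem⟩ := exists_finset_card_eq_occCount (fun j => (Φ j).1) v
        obtain ⟨T, hT, hTc⟩ := Finset.exists_subset_card_eq (hs ▸ hocc v hv)
        refine ⟨T, ?_, fun j hj => mem_clauseVars.2 ((hmem j).1 (hT hj))⟩
        rw [if_pos hv]
        exact Finset.mem_powersetCard.2 ⟨Finset.subset_univ _, hTc⟩
      · exact ⟨∅, by simp [hv], by simp⟩
    choose T hT hmem using hex
    refine ⟨⟨U, T⟩, Finset.mem_sigma.2 ⟨Finset.mem_powersetCard.2 ⟨Finset.subset_univ _, hU⟩,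
      Fintype.mem_piFinset.2 hT⟩, fun j u hu => hmem u j (Finset.mem_filter.1 hu).2⟩
  · refine (Finset.sum_le_card_nsmul _ _ (((k : ℝ) / n) ^ (t * b)) ?_).trans ?_
    · rintro ⟨U, T⟩ hp
      obtain ⟨hU, hT⟩ := Finset.mem_sigma.1 hp
      have hU := (Finset.mem_powersetCard.1 hU).2
      have hT := Fintype.mem_piFinset.1 hT
      rw [uniformProb_forall (fun j C => (U.filter fun u => j ∈ T u) ⊆ clauseVars C.1)]
      -- Clause `j` must contain every `u` with `j ∈ T u`; double counting gives the total number of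
      -- prescribed incidences.
      have hsum : ∑ j, (U.filter fun u => j ∈ T u).card = t * b := by
        have h := Finset.sum_card_bipartiteAbove_eq_sum_card_bipartiteBelow
          (s := (Finset.univ : Finset (Fin m))) (t := U) (fun j u => j ∈ T u)
        unfold Finset.bipartiteAbove Finset.bipartiteBelow at h
        rw [h, mul_comm, ← hU]
        refine Finset.sum_const_nat fun u hu => ?_
        have := hT u
        dsimp only at this
        rw [if_pos hu, Finset.mem_powersetCard] at this
        rw [Finset.filter_mem_eq_inter, Finset.univ_inter, this.2]
      rw [← hsum, ← Finset.prod_pow_eq_pow_sum]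
      exact Finset.prod_le_prod (fun j _ => uniformProb_nonneg _ _) fun j _ =>
        uniformProb_subset_clauseVars_le hk hkn _
    · have hI : I.card = n.choose b * (m.choose t) ^ b := by
        rw [Finset.card_sigma]
        have h1 : (Finset.univ.powersetCard b : Finset (Finset (Fin n))).card = n.choose b := by
          simp
        rw [← h1]
        refine Finset.sum_const_nat fun U hU => ?_
        rw [Fintype.card_piFinset, ← (Finset.mem_powersetCard.1 hU).2, ← Finset.prod_const]
        have h2 : ∀ v, (if v ∈ U then (Finset.univ.powersetCard t : Finset (Finset (Fin m)))
            else {∅}).card = if v ∈ U then m.choose t else 1 := by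
          intro v
          split_ifs <;> simp
        simp only [h2]
        rw [Finset.prod_ite_mem, Finset.univ_inter]
      rw [hI, nsmul_eq_mul]
      push_cast
      exact le_rfl

theorem uniformProb_exists_occCount_ge_le (hk : 1 ≤ k) (hkn : k ≤ n) {b t : ℕ} (hb : 1 ≤ b)
    (ht : 1 ≤ t) {α : ℝ} (hα : α = m / n) :
    uniformProb (Finset.univ : Finset (KCNF k n m)) (fun Φ => ∃ U : Finset (Fin n), U.card = b ∧
      ∀ u ∈ U, t ≤ occCount (fun j => (Φ j).1) u) ≤
      (Real.exp 1 * n / b * (Real.exp 1 * α * k / t) ^ t) ^ b := by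
  refine (uniformProb_exists_occCount_ge hk hkn b t).trans ?_
  have h1 := choose_le_exp_mul_div_pow n hb
  have h2 := choose_le_exp_mul_div_pow m ht
  calc (n.choose b * (m.choose t) ^ b * ((k : ℝ) / n) ^ (t * b) : ℝ)
      ≤ (Real.exp 1 * n / b) ^ b * ((Real.exp 1 * m / t) ^ t) ^ b * ((k : ℝ) / n) ^ (t * b) := by
        gcongr
    _ = (Real.exp 1 * n / b * (Real.exp 1 * α * k / t) ^ t) ^ b := by
        rw [pow_mul, ← mul_pow, ← mul_pow, mul_assoc, ← mul_pow, hα]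
        congr 3
        ring

theorem sum_succ_mul_half_pow_le (b : ℕ) :
    ∑ i ∈ Finset.range b, ((i : ℝ) + 1) * (1 / 2) ^ i ≤ 4 := by
  have key : ∑ i ∈ Finset.range b, ((i : ℝ) + 1) * (1 / 2) ^ i = 4 - (2 * b + 4) * (1 / 2) ^ b := by
    induction b with
    | zero => simp
    | succ b ih =>
      rw [Finset.sum_range_succ, ih]
      push_cast
      ring
  rw [key]
  have : (0 : ℝ) ≤ (2 * b + 4) * (1 / 2) ^ b := by positivity
  linarith

/-- With high probability, small sets of clauses of a random formula expand. -/
theorem uniformProb_not_expanding_le {r b : ℕ} (hr : 2 ≤ r) (hrk : r < k) (hkn : k ≤ n)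
    (hb : k * b ≤ n) {α : ℝ} (hα : α = m / n)
    (hq : Real.exp 1 * Real.exp 1 ^ k * α * (k : ℝ) ^ r * ((b : ℝ) / n) ^ (r - 1) ≤ 1 / 2) :
    uniformProb (Finset.univ : Finset (KCNF k n m)) (fun Φ => ¬ ∀ S : Finset (Fin m), S.Nonempty →
      S.card ≤ b → (k - r) * S.card < (varSet (fun j => (Φ j).1) S).card) ≤
      4 * (Real.exp 1 * Real.exp 1 ^ k * α * (k : ℝ) ^ r / n) := by
  have hn : (0 : ℝ) < n := by exact_mod_cast (by omega : 0 < n)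
  have hα0 : 0 ≤ α := by rw [hα]; positivity
  set K : ℝ := Real.exp 1 * Real.exp 1 ^ k * α * (k : ℝ) ^ r with hK
  have hK0 : 0 ≤ K := by positivity
  refine (uniformProb_le_sum _ (Finset.range b) _ (fun i Φ => ∃ S : Finset (Fin m),
    S.card = i + 1 ∧ (varSet (fun j => (Φ j).1) S).card ≤ (k - r) * (i + 1)) ?_).trans ?_
  · intro Φ _ h
    push Not at h
    obtain ⟨S, hne, hSb, hS⟩ := h
    have := hne.card_pos
    refine ⟨S.card - 1, Finset.mem_range.2 (by omega), S, by omega, ?_⟩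
    rwa [Nat.sub_add_cancel this]
  have hterm : ∀ i ∈ Finset.range b, uniformProb (Finset.univ : Finset (KCNF k n m))
      (fun Φ => ∃ S : Finset (Fin m), S.card = i + 1 ∧
        (varSet (fun j => (Φ j).1) S).card ≤ (k - r) * (i + 1)) ≤
      K / n * (((i : ℝ) + 1) * (1 / 2) ^ i) := by
    intro i hi
    have hi := Finset.mem_range.1 hi
    set s := i + 1 with hs
    have hs0 : (0 : ℝ) < s := by rw [hs]; positivity
    have hksn : k * s ≤ n := (Nat.mul_le_mul_left _ (by omega)).trans hb
    have hw1 : 1 ≤ (k - r) * s := Nat.mul_pos (by omega) (by omega)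
    have hwk : (k - r) * s ≤ k * s := Nat.mul_le_mul_right _ (Nat.sub_le _ _)
    refine (uniformProb_exists_varSet_card_le (by omega) hkn s (hwk.trans hksn)).trans ?_
    set w := (k - r) * s with hw
    have hw0 : (0 : ℝ) < w := by exact_mod_cast hw1
    have hsum : k * s = w + r * s := by
      rw [hw, ← add_mul, Nat.sub_add_cancel hrk.le]
    have hwks : (w : ℝ) ≤ k * s := by exact_mod_cast hwk
    have hsn : (s : ℝ) / n ≤ 1 := by
      rw [div_le_one hn]
      exact_mod_cast le_trans (Nat.le_mul_of_pos_left _ (by omega)) hksn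
    have h1 := choose_le_exp_mul_div_pow m (r := s) (by omega)
    have h2 := choose_le_exp_mul_div_pow n hw1
    have he : (1 : ℝ) ≤ Real.exp 1 := Real.one_le_exp (by norm_num)
    have hrpow : ((s : ℝ) / n) ^ r = ((s : ℝ) / n) ^ (r - 1) * (s / n) := by
      rw [← pow_succ, Nat.sub_add_cancel (by omega)]
    -- As `k s = w + r s`, a factor `(w / n) ^ w` cancels the `(n / w) ^ w` from `C(n, w)`, leaving
    -- `e ^ w` and `(w / n) ^ (r s)`.
    have hbound : (m.choose s * n.choose w * ((w : ℝ) / n) ^ (k * s) : ℝ) ≤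
        (K * ((s : ℝ) / n) ^ (r - 1)) ^ s := by
      calc (m.choose s * n.choose w * ((w : ℝ) / n) ^ (k * s) : ℝ)
          ≤ (Real.exp 1 * m / s) ^ s * (Real.exp 1 * n / w) ^ w * ((w : ℝ) / n) ^ (k * s) := by
            gcongr
        _ = (Real.exp 1 * m / s) ^ s * Real.exp 1 ^ w * ((w : ℝ) / n) ^ (r * s) := by
            have h3 : Real.exp 1 * n / w * ((w : ℝ) / n) = Real.exp 1 := by field_simp
            rw [hsum, pow_add ((w : ℝ) / n), ← mul_assoc, mul_assoc ((Real.exp 1 * m / s) ^ s),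
              ← mul_pow, h3]
        _ ≤ (Real.exp 1 * m / s) ^ s * Real.exp 1 ^ (k * s) * ((k * s : ℝ) / n) ^ (r * s) := by
            gcongr
        _ = (Real.exp 1 * m / s * Real.exp 1 ^ k * ((k * s : ℝ) / n) ^ r) ^ s := by
            rw [pow_mul, pow_mul, ← mul_pow, ← mul_pow]
        _ = (K * ((s : ℝ) / n) ^ (r - 1)) ^ s := by
            congr 1
            rw [mul_div_assoc (k : ℝ), mul_pow, hrpow, hK, hα]
            field_simp
    refine hbound.trans ?_
    have hq2 : K * ((s : ℝ) / n) ^ (r - 1) ≤ 1 / 2 := by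
      refine le_trans ?_ hq
      have : (s : ℝ) ≤ b := by exact_mod_cast (by omega : s ≤ b)
      gcongr
    have hq1 : K * ((s : ℝ) / n) ^ (r - 1) ≤ K * (s / n) := by
      gcongr
      exact pow_le_of_le_one (by positivity) hsn (by omega)
    have hq0 : 0 ≤ K * ((s : ℝ) / n) ^ (r - 1) := by positivity
    -- One of the `s = i + 1` factors is kept as `K s / n` to gain `1 / n`; the other `i` are at
    -- most `1 / 2` and make the sum over `i` converge.
    calc (K * ((s : ℝ) / n) ^ (r - 1)) ^ s
        = (K * ((s : ℝ) / n) ^ (r - 1)) ^ i * (K * ((s : ℝ) / n) ^ (r - 1)) := pow_succ _ _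
      _ ≤ (1 / 2) ^ i * (K * (s / n)) := by gcongr
      _ = K / n * (((i : ℝ) + 1) * (1 / 2) ^ i) := by rw [hs]; push_cast; ring
  refine (Finset.sum_le_sum hterm).trans ?_
  rw [← Finset.mul_sum, mul_comm 4]
  exact mul_le_mul_of_nonneg_left (sum_succ_mul_half_pow_le b) (by positivity)

end FirstMoment

/-! ### Deterministic criteria for connectivity. -/

namespace KCNF

variable {k n m : ℕ}

/-- The formula consisting of all clauses on `k` fixed variables is unsatisfiable. -/
theorem exists_unsatisfiable (hkn : k ≤ n) : ∃ (m : ℕ) (Φ : KCNF k n m),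
    Φ.IsBoundedDegree (2 ^ k) ∧ ¬ Φ.solutions.Nonempty := by
  classical
  let e := Fintype.equivFin (Fin k → Bool)
  let f : (Fin k → Bool) → Finset (Literal n) := fun s =>
    Finset.univ.image fun a => (Fin.castLE hkn a, s a)
  have hinj : ∀ s : Fin k → Bool, Function.Injective fun a => (Fin.castLE hkn a, s a) :=
    fun s a b h => Fin.castLE_injective hkn (congrArg Prod.fst h)
  let Φ : KCNF k n (Fintype.card (Fin k → Bool)) := fun i => ⟨f (e.symm i), by
    rw [Finset.card_image_of_injective _ (hinj _)]; simp, by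
    intro l hl l' hl' h
    obtain ⟨a, _, rfl⟩ := Finset.mem_image.1 hl
    obtain ⟨b, _, rfl⟩ := Finset.mem_image.1 hl'
    rw [Fin.castLE_injective hkn h]⟩
  refine ⟨_, Φ, fun v => ?_, ?_⟩
  · refine (Finset.card_le_univ _).trans ?_
    simp
  · rintro ⟨σ, hσ⟩
    obtain ⟨l, hl, hl'⟩ := (mem_solutions Φ σ).1 hσ (e fun a => !σ (Fin.castLE hkn a))
    simp only [Φ, Equiv.symm_apply_apply] at hl
    obtain ⟨a, _, rfl⟩ := Finset.mem_image.1 hl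
    simp at hl'

theorem RandomPairConnected.mono {Φ : KCNF k n m} {D D' ε : ℝ} (h : Φ.RandomPairConnected D ε)
    (hD : D ≤ D') : Φ.RandomPairConnected D' ε :=
  ⟨h.1, h.2.trans (uniformProb_mono fun _ _ ⟨ℓ, ζ, hζ, h0, h1⟩ =>
    ⟨ℓ, ζ, ⟨hζ.1, fun i => (hζ.2 i).trans hD⟩, h0, h1⟩)⟩

/-- If all sets of clauses expand, all solutions are connected by flips of single variables. -/
theorem connected_of_expansion {Φ : KCNF k n m} {r : ℕ} (hr : 2 * r ≤ k) {D ε : ℝ}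
    (hD : 1 ≤ D) (hε : 0 ≤ ε)
    (hexp : ∀ S : Finset (Fin m), S.Nonempty →
      (k - r) * S.card < (varSet (fun j => (Φ j).1) S).card) :
    Φ.RandomPairConnected D ε ∧ Φ.HasGiantComponent D ε := by
  classical
  have hpeel : Peelable (fun j => (Φ j).1) Finset.univ := by
    refine peelable_of_expansion Φ.isKClause fun T _ hT => ?_
    have h1 := hexp T hT
    have h2 : k * T.card ≤ 2 * ((k - r) * T.card) := by
      rw [← mul_assoc]
      exact Nat.mul_le_mul_right _ (by omega)
    omega
  obtain ⟨⟨σ, hσ⟩, hlink⟩ := hpeel.linked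
  have hiff : ∀ τ, FamilySat (fun j : (Finset.univ : Finset (Fin m)) => (Φ j.1).1) τ ↔
      FamilySat (fun j => (Φ j).1) τ :=
    fun τ => ⟨fun h j => h ⟨j, Finset.mem_univ j⟩, fun h j => h j.1⟩
  refine connected_of_large_class (δ := 0) (by simpa using hε) le_rfl zero_le_one
    ((hiff σ).1 hσ) ?_
  rw [sub_zero, one_mul, Nat.cast_le]
  refine Finset.card_le_card fun τ hτ => Finset.mem_filter.2 ⟨hτ, ?_⟩
  have h := hlink σ τ hσ ((hiff τ).2 (mem_solSet.1 hτ))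
  exact (h.map id (fun τ => (hiff τ).1) fun _ _ => le_rfl).mono hD

/-- A formula in which small sets of clauses expand and few variables have large degree has
connected random pairs and a giant component, if bounded degree formulas have connected random
pairs. -/
theorem connected_of_few_large_degrees {Φ : KCNF k n m} {b d t M : ℕ} {D ε : ℝ} (hk : 6 ≤ k)
    (hb : 1 ≤ b) (hd : 1 ≤ d) (hkd : 4 * (k * d) ≤ 2 ^ (k - 3)) (hM : 2 * 2 ^ t < M)
    (hD : 1 ≤ D) (hε : 2 * (1 / (M : ℝ)) ≤ ε)
    (hexp : ∀ S : Finset (Fin m), S.Nonempty → S.card ≤ b →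
      (k - 3) * S.card < (varSet (fun j => (Φ j).1) S).card)
    (hdeg : ¬ ∃ U : Finset (Fin n), U.card = b ∧ ∀ u ∈ U, d ≤ occCount (fun j => (Φ j).1) u)
    (hmax : ¬ ∃ U : Finset (Fin n), U.card = 1 ∧ ∀ u ∈ U, t ≤ occCount (fun j => (Φ j).1) u)
    (H : ∀ (m' : ℕ) (Ψ : KCNF k (M * (n * (m + 1))) m'), Ψ.IsBoundedDegree (8 * d) →
      Ψ.RandomPairConnected D (1 / 2)) :
    Φ.RandomPairConnected D ε ∧ Φ.HasGiantComponent D ε := by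
  classical
  have hMpos : 1 ≤ M := by omega
  set F : Fin m → Finset (Literal n) := fun j => (Φ j).1 with hF
  have hB₀ : (Finset.univ.filter fun v => d ≤ occCount F v).card ≤ b := by
    by_contra! hcon
    obtain ⟨U, hU, hUc⟩ := Finset.exists_subset_card_eq hcon.le
    exact hdeg ⟨U, hUc, fun u hu => (Finset.mem_filter.1 (hU hu)).2⟩
  obtain ⟨B, hBB, hgood, hpeel⟩ := exists_closure hk hb Φ.isKClause _ hB₀ hexp
  obtain ⟨σ, hσ, hcard⟩ := exists_giant_linked_class (M := M) (Δ := t) (D := D) Φ.isKClause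
    (B := B) hd
    (by
      intro v hv
      by_contra! hcon
      exact hv (hBB (Finset.mem_filter.2 ⟨Finset.mem_univ _, hcon.le⟩)))
    (by
      intro v
      by_contra! hcon
      exact hmax ⟨{v}, Finset.card_singleton v, fun u hu => by
        rw [Finset.mem_singleton.1 hu]; exact hcon.le⟩)
    (by omega) hkd hgood hpeel hM hD (by rw [Fintype.card_fin, Fintype.card_fin]; exact H)
  refine connected_of_large_class hε (by positivity) ?_ hσ hcard
  rw [div_le_one (by exact_mod_cast hMpos)]
  exact_mod_cast hMpos

end KCNF

/-! ### Sparse and dense random formulas. -/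

section RandomFormula

variable {k n m : ℕ}

/-- Sparse random formulas. -/
theorem connected_prob_of_sparse (hk : 10 ≤ k) (hkn : k ≤ n) {α D ε : ℝ} (hα : α = m / n)
    (hαk : α * (k : ℝ) ^ 3 ≤ 1) (hD : 1 ≤ D) (hε : 0 < ε)
    (hn : 4 * (Real.exp 1 * Real.exp 1 ^ k * (k : ℝ) ^ k) ≤ ε * n) :
    1 - ε ≤ uniformProb (Finset.univ : Finset (KCNF k n m)) fun Φ =>
      Φ.RandomPairConnected D ε ∧ Φ.HasGiantComponent D ε := by
  have hn0 : (0 : ℝ) < n := by exact_mod_cast (by omega : 0 < n)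
  have hkr : (10 : ℝ) ≤ k := by exact_mod_cast hk
  have hα0 : 0 ≤ α := by rw [hα]; positivity
  have hαk' : α ≤ 1 / (k : ℝ) ^ 3 := by rwa [le_div_iff₀ (by positivity)]
  have hα1 : α ≤ 1 := hαk'.trans (by
    rw [div_le_one (by positivity)]; exact one_le_pow₀ (by linarith))
  have hm : (m : ℝ) = α * n := by rw [hα]; field_simp
  -- Peeling tolerates a loss `r` up to `k / 2`. Taking it this large turns `α k ^ 3 ≤ 1` into `(α
  -- k) ^ r ≤ k ^ (-2 r)`, which beats `e ^ k` and allows `b = m`, that is, all sets of clauses.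
  obtain ⟨r, hr⟩ : ∃ r, r = k / 2 := ⟨_, rfl⟩
  have hkm : k * m ≤ n := by
    have : (k : ℝ) * m ≤ n := by
      rw [hm, ← mul_assoc]
      have : (k : ℝ) * α ≤ 1 := by
        calc (k : ℝ) * α ≤ α * (k : ℝ) ^ 3 := by
              rw [mul_comm]
              gcongr
              exact le_self_pow₀ (by linarith) (by norm_num)
          _ ≤ 1 := hαk
      nlinarith
    exact_mod_cast this
  have he : Real.exp 1 ≤ 3 := by linarith [Real.exp_one_lt_d9]
  have hq : Real.exp 1 * Real.exp 1 ^ k * α * (k : ℝ) ^ r * ((m : ℝ) / n) ^ (r - 1) ≤ 1 / 2 := by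
    rw [← hα]
    have h1 : α * α ^ (r - 1) = α ^ r := by
      rw [← pow_succ', Nat.sub_add_cancel (by omega)]
    calc Real.exp 1 * Real.exp 1 ^ k * α * (k : ℝ) ^ r * α ^ (r - 1)
        = Real.exp 1 * Real.exp 1 ^ k * (k : ℝ) ^ r * (α * α ^ (r - 1)) := by ring
      _ ≤ 3 * 3 ^ k * (k : ℝ) ^ r * (1 / (k : ℝ) ^ 3) ^ r := by
          rw [h1]
          gcongr
      _ = 3 * 3 ^ k * (1 / (k : ℝ) ^ 2) ^ r := by
          rw [mul_assoc, ← mul_pow]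
          congr 2
          field_simp
      _ ≤ 3 * 3 ^ (2 * r + 1) * (1 / (10 : ℝ) ^ 2) ^ r := by
          gcongr
          · norm_num
          · omega
      _ = 9 * (9 / 100) ^ r := by
          rw [pow_succ, pow_mul, show (9 / 100 : ℝ) = 3 ^ 2 * (1 / 10 ^ 2) by norm_num, mul_pow]
          ring
      _ ≤ 9 * (9 / 100) ^ 2 := by
          gcongr ?_ * ?_
          exact pow_le_pow_of_le_one (by norm_num) (by norm_num) (by omega)
      _ ≤ 1 / 2 := by norm_num
  have hprob := uniformProb_not_expanding_le (m := m) (r := r) (b := m) (by omega) (by omega) hkn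
    hkm hα hq
  refine le_trans ?_ (one_sub_uniformProb_le (nonempty_kCNF hkn m) _
    (fun Φ => ¬ ∀ S : Finset (Fin m), S.Nonempty → S.card ≤ m →
      (k - r) * S.card < (varSet (fun j => (Φ j).1) S).card) fun Φ _ hΦ =>
    KCNF.connected_of_expansion (r := r) (by omega) hD hε.le fun S hS =>
      not_not.1 hΦ S hS (by simpa using Finset.card_le_univ S))
  · refine sub_le_sub_left (hprob.trans ?_) 1
    rw [← mul_div_assoc, div_le_iff₀ hn0]
    refine le_trans ?_ hn
    have : α * (k : ℝ) ^ r ≤ 1 * (k : ℝ) ^ k := by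
      gcongr
      · linarith
      · omega
    rw [one_mul] at this
    calc 4 * (Real.exp 1 * Real.exp 1 ^ k * α * (k : ℝ) ^ r)
        = 4 * (Real.exp 1 * Real.exp 1 ^ k * (α * (k : ℝ) ^ r)) := by ring
      _ ≤ _ := by gcongr

/-- Dense random formulas. -/
theorem connected_prob_of_dense {d : ℕ} (hk : 10 ≤ k) (hkn : k ≤ n) {α D ε : ℝ} (hα : α = m / n)
    (hα2 : α ≤ 2 ^ k) (hdk : 4 * k ≤ d) (hdα : 4 * Real.exp 1 * α * k ≤ d)
    (hkd : 4 * (k * d) ≤ 2 ^ (k - 3))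
    (hkexp : Real.exp 1 * Real.exp 1 ^ k * 2 ^ k * (k : ℝ) ^ 3 * (1 / 4 ^ k) ^ 2 ≤ 1 / 2)
    (hD : 1 ≤ D) (hn4 : 4 ^ k ≤ n)
    (hn1 : 12 * (Real.exp 1 * Real.exp 1 ^ k * 2 ^ k * (k : ℝ) ^ 3) ≤ ε * n)
    (hn2 : 3 * 4 ^ k ≤ ε * n) (hn3 : 9 ≤ ε * n)
    (hlog : Real.exp 1 ^ 3 * 2 ^ k * k ≤ Real.log n)
    (H : ∀ (m' : ℕ) (Ψ : KCNF k (n ^ 2 * (n * (m + 1))) m'), Ψ.IsBoundedDegree (8 * d) →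
      Ψ.RandomPairConnected D (1 / 2)) :
    1 - ε ≤ uniformProb (Finset.univ : Finset (KCNF k n m)) fun Φ =>
      Φ.RandomPairConnected D ε ∧ Φ.HasGiantComponent D ε := by
  have hn0 : (0 : ℝ) < n := by exact_mod_cast (by omega : 0 < n)
  have hn10 : (10 : ℝ) ≤ n := by exact_mod_cast (by omega : 10 ≤ n)
  have hkr : (10 : ℝ) ≤ k := by exact_mod_cast hk
  have hα0 : 0 ≤ α := by rw [hα]; positivity
  have he3 : Real.exp 1 ≤ 3 := by linarith [Real.exp_one_lt_d9]
  have he2 : 2 ≤ Real.exp 1 := by linarith [Real.exp_one_gt_d9]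
  have h4pos : 0 < 4 ^ k := by positivity
  -- `b` is linear in `n`, yet `(b / n) ^ 2 ≤ 16 ^ (-k)` defeats the factors `e ^ k` and `α ≤ 2 ^ k`
  -- in the expansion bound. The degree bound `t` is large enough for a union bound over variables,
  -- while `2 ^ t` stays below `n ^ 2 / 2`.
  obtain ⟨b, hb⟩ : ∃ b, b = n / 4 ^ k := ⟨_, rfl⟩
  obtain ⟨t, ht⟩ : ∃ t, t = ⌈Real.log n⌉₊ := ⟨_, rfl⟩
  have hb1 : 1 ≤ b := by rw [hb]; exact Nat.div_pos hn4 h4pos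
  have hbn : b * 4 ^ k ≤ n := by rw [hb]; exact Nat.div_mul_le_self _ _
  have hnb : n < (b + 1) * 4 ^ k := by
    rw [hb, add_mul, one_mul]
    exact Nat.lt_div_mul_add h4pos
  have hbn' : (b : ℝ) * 4 ^ k ≤ n := by exact_mod_cast hbn
  have hnb' : (n : ℝ) < (b + 1) * 4 ^ k := by exact_mod_cast hnb
  have hb1' : (1 : ℝ) ≤ b := by exact_mod_cast hb1
  have hkb : k * b ≤ n := by
    refine le_trans ?_ hbn
    rw [mul_comm]
    exact Nat.mul_le_mul_left _ (Nat.lt_pow_self (by norm_num)).le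
  have hlog0 : 0 < Real.log n := lt_of_lt_of_le (by positivity) hlog
  have ht1 : 1 ≤ t := by rw [ht]; exact Nat.ceil_pos.2 hlog0
  have htlog : Real.log n ≤ t := by rw [ht]; exact Nat.le_ceil _
  have htlog' : (t : ℝ) ≤ Real.log n + 1 := by rw [ht]; exact (Nat.ceil_lt_add_one hlog0.le).le
  have hexpP := uniformProb_not_expanding_le (k := k) (m := m) (r := 3) (b := b) (by norm_num)
    (by omega) hkn hkb hα (by
      refine le_trans ?_ hkexp
      have h1 : (b : ℝ) / n ≤ 1 / 4 ^ k := by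
        rw [div_le_div_iff₀ hn0 (by positivity)]; linarith
      norm_num only
      gcongr)
  have hdegP := uniformProb_exists_occCount_ge_le (k := k) (m := m) (b := b) (t := d) (by omega)
    hkn hb1 (by omega) hα
  have hmaxP := uniformProb_exists_occCount_ge_le (k := k) (m := m) (b := 1) (t := t) (by omega)
    hkn le_rfl ht1 hα
  have hexpB : 4 * (Real.exp 1 * Real.exp 1 ^ k * α * (k : ℝ) ^ 3 / n) ≤ ε / 3 := by
    rw [← mul_div_assoc, div_le_iff₀ hn0]
    have : Real.exp 1 * Real.exp 1 ^ k * α * (k : ℝ) ^ 3 ≤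
        Real.exp 1 * Real.exp 1 ^ k * 2 ^ k * (k : ℝ) ^ 3 := by gcongr
    linarith
  have hd0 : (0 : ℝ) < d := by exact_mod_cast (by omega : 0 < d)
  -- The tail `4 ^ (-d)`, with `d ≥ k + 3`, outweighs `n / b ≤ 2 * 4 ^ k`, so the base is at most `1
  -- / 2`; then `2 ^ (-b) ≤ 1 / (b + 1) ≤ 4 ^ k / n`.
  have hdegB : (Real.exp 1 * n / b * (Real.exp 1 * α * k / d) ^ d) ^ b ≤ ε / 3 := by
    have h1 : Real.exp 1 * α * k / d ≤ 1 / 4 := by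
      rw [div_le_div_iff₀ hd0 (by norm_num)]; linarith
    have h2 : (Real.exp 1 * α * k / d) ^ d ≤ (1 / 4) ^ (k + 3) := by
      calc (Real.exp 1 * α * k / d) ^ d ≤ (1 / 4) ^ d := by gcongr
        _ ≤ _ := pow_le_pow_of_le_one (by norm_num) (by norm_num) (by omega)
    have h3 : (n : ℝ) / b ≤ 2 * 4 ^ k := by
      rw [div_le_iff₀ (by linarith)]
      have : (0 : ℝ) < 4 ^ k := by positivity
      nlinarith
    have h4 : Real.exp 1 * n / b * (Real.exp 1 * α * k / d) ^ d ≤ 1 / 2 := by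
      rw [mul_div_assoc]
      calc Real.exp 1 * (n / b) * (Real.exp 1 * α * k / d) ^ d
          ≤ 3 * (2 * 4 ^ k) * (1 / 4) ^ (k + 3) := by gcongr
        _ = 6 * (4 * (1 / 4)) ^ k * (1 / 4) ^ 3 := by rw [mul_pow, pow_add]; ring
        _ ≤ 1 / 2 := by norm_num
    calc (Real.exp 1 * n / b * (Real.exp 1 * α * k / d) ^ d) ^ b ≤ (1 / 2) ^ b := by gcongr
      _ ≤ 4 ^ k / n := by
        have h5 : ((b + 1 : ℕ) : ℝ) ≤ ((2 ^ b : ℕ) : ℝ) :=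
          Nat.cast_le.2 (Nat.lt_pow_self (by norm_num))
        push_cast at h5
        rw [one_div_pow, div_le_div_iff₀ (by positivity) hn0, one_mul, mul_comm]
        refine hnb'.le.trans ?_
        gcongr
      _ ≤ ε / 3 := by
        rw [div_le_div_iff₀ hn0 (by norm_num)]
        linarith
  -- For large `n`, `e α k ≤ e ^ (-2) log n`, so the tail is at most `e ^ (-2 t) ≤ n ^ (-2)`, enough
  -- against the `n` choices of a variable.
  have hmaxB : (Real.exp 1 * n / (1 : ℕ) * (Real.exp 1 * α * k / t) ^ t) ^ 1 ≤ ε / 3 := by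
    have ht0 : (0 : ℝ) < t := by exact_mod_cast ht1
    have h1 : Real.exp 1 * α * k / t ≤ Real.exp (-2) := by
      have e1 : Real.exp 1 * α * k ≤ Real.exp (-2) * t := by
        calc Real.exp 1 * α * k ≤ Real.exp 1 * 2 ^ k * k := by gcongr
          _ = Real.exp (-2) * (Real.exp 1 ^ 3 * 2 ^ k * k) := by
            rw [← Real.exp_nat_mul, ← mul_assoc, ← mul_assoc, ← Real.exp_add]
            norm_num
          _ ≤ Real.exp (-2) * t := by gcongr; linarith
      rwa [div_le_iff₀ ht0]
    have h2 : (Real.exp 1 * α * k / t) ^ t ≤ 1 / (n : ℝ) ^ 2 := by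
      calc (Real.exp 1 * α * k / t) ^ t ≤ Real.exp (-2) ^ t := by gcongr
        _ = Real.exp (-(2 * t)) := by rw [← Real.exp_nat_mul]; congr 1; ring
        _ ≤ Real.exp (-(2 * Real.log n)) := by gcongr
        _ = 1 / (n : ℝ) ^ 2 := by
          rw [Real.exp_neg, one_div, two_mul, Real.exp_add, Real.exp_log hn0, sq]
    rw [pow_one, Nat.cast_one, div_one]
    calc Real.exp 1 * n * (Real.exp 1 * α * k / t) ^ t ≤ 3 * n * (1 / (n : ℝ) ^ 2) := by gcongr
      _ = 3 / n := by field_simp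
      _ ≤ ε / 3 := by
        rw [div_le_div_iff₀ hn0 (by norm_num)]
        linarith
  have hM : 2 * 2 ^ t < n ^ 2 := by
    have h1 : (2 : ℝ) ^ t ≤ 3 * n := by
      calc (2 : ℝ) ^ t ≤ Real.exp 1 ^ t := by gcongr
        _ = Real.exp t := by rw [← Real.exp_nat_mul, mul_one]
        _ ≤ Real.exp (Real.log n + 1) := by gcongr
        _ = Real.exp 1 * n := by rw [Real.exp_add, Real.exp_log hn0, mul_comm]
        _ ≤ 3 * n := by gcongr
    have h2 : (2 : ℝ) * 2 ^ t < (n : ℝ) ^ 2 := by nlinarith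
    exact_mod_cast h2
  have hεM : 2 * (1 / ((n ^ 2 : ℕ) : ℝ)) ≤ ε := by
    push_cast
    rw [mul_one_div, div_le_iff₀ (by positivity)]
    nlinarith
  set E₁ : KCNF k n m → Prop := fun Φ => ¬ ∀ S : Finset (Fin m), S.Nonempty →
      S.card ≤ b → (k - 3) * S.card < (varSet (fun j => (Φ j).1) S).card with hE₁
  set E₂ : KCNF k n m → Prop := fun Φ => ∃ U : Finset (Fin n), U.card = b ∧
      ∀ u ∈ U, d ≤ occCount (fun j => (Φ j).1) u with hE₂
  set E₃ : KCNF k n m → Prop := fun Φ => ∃ U : Finset (Fin n), U.card = 1 ∧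
      ∀ u ∈ U, t ≤ occCount (fun j => (Φ j).1) u with hE₃
  have hunion : uniformProb (Finset.univ : Finset (KCNF k n m))
      (fun Φ => E₁ Φ ∨ E₂ Φ ∨ E₃ Φ) ≤ ε := by
    have h := uniformProb_le_sum (Finset.univ : Finset (KCNF k n m)) (Finset.univ : Finset (Fin 3))
      (fun Φ => E₁ Φ ∨ E₂ Φ ∨ E₃ Φ) ![E₁, E₂, E₃] (by
        rintro Φ - (h | h | h)
        · exact ⟨0, Finset.mem_univ _, h⟩
        · exact ⟨1, Finset.mem_univ _, h⟩
        · exact ⟨2, Finset.mem_univ _, h⟩)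
    rw [Fin.sum_univ_three] at h
    have e1 := hexpP.trans hexpB
    have e2 := hdegP.trans hdegB
    have e3 := hmaxP.trans hmaxB
    refine h.trans ?_
    change uniformProb _ E₁ + uniformProb _ E₂ + uniformProb _ E₃ ≤ ε
    linarith
  refine le_trans (sub_le_sub_left hunion 1) (one_sub_uniformProb_le (nonempty_kCNF hkn m) _ _ ?_)
  intro Φ _ hΦ
  push Not at hΦ
  obtain ⟨h1, h2, h3⟩ := hΦ
  exact KCNF.connected_of_few_large_degrees (by omega) hb1 (by omega) hkd hM hD hεM
    h1 h2 h3 H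

end RandomFormula

/-! ### Numerical estimates for the parameters. -/

section Parameters

theorem eventually_pow_le_mul_pow (a : ℕ) {x c r : ℝ} (hc : 0 < c) (hx : 0 < x) (hr : 1 < r) :
    ∀ᶠ k : ℕ in Filter.atTop, x * (k : ℝ) ^ a ≤ c * r ^ k := by
  have h := (tendsto_pow_const_div_const_pow_of_one_lt a hr).eventually
    (gt_mem_nhds (show (0 : ℝ) < c / x by positivity))
  filter_upwards [h] with k hk
  have hrk : 0 < r ^ k := by positivity
  rw [div_lt_div_iff₀ hrk hx] at hk
  linarith

theorem eventually_le_mul_natCast (X : ℝ) {ε : ℝ} (hε : 0 < ε) :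
    ∀ᶠ n : ℕ in Filter.atTop, X ≤ ε * (n : ℝ) :=
  (tendsto_natCast_atTop_atTop.const_mul_atTop hε).eventually_ge_atTop X

/-- Bounded degree connectivity cannot hold beyond the satisfiability threshold. -/
theorem BoundedDegreeConnectivity.lt_two_pow {k N : ℕ} {T : ℝ} {D : ℕ → ℕ → ℝ}
    (h : ∀ n : ℕ, N ≤ n → ∀ d : ℕ, 1 ≤ d → (d : ℝ) ≤ T →
      ∀ (m : ℕ) (Φ : KCNF k n m), Φ.IsBoundedDegree d → Φ.RandomPairConnected (D d n) (1 / 2)) :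
    T < 2 ^ k := by
  by_contra! hcon
  obtain ⟨m, Φ, hΦ, hne⟩ := KCNF.exists_unsatisfiable (k := k) (n := max N k) (le_max_right _ _)
  exact hne (h _ (le_max_left _ _) (2 ^ k) Nat.one_le_two_pow (by push_cast; exact hcon) m Φ hΦ).1

/-- The exponential factors combine to `(2 e / 16) ^ k = (e / 8) ^ k`. This is the expansion
condition for `r = 3` and `b ≤ n / 4 ^ k`. -/
theorem exp_mul_pow_le_half {k : ℕ}
    (h : Real.exp 1 * (k : ℝ) ^ 3 ≤ 1 / 2 * (8 / Real.exp 1) ^ k) :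
    Real.exp 1 * Real.exp 1 ^ k * 2 ^ k * (k : ℝ) ^ 3 * (1 / 4 ^ k) ^ 2 ≤ 1 / 2 := by
  have h1 : ((1 : ℝ) / 4 ^ k) ^ 2 * 2 ^ k = 1 / 8 ^ k := by
    have h2 : ((4 : ℝ) ^ k) ^ 2 = 2 ^ k * 8 ^ k := by
      rw [← mul_pow, ← pow_mul, mul_comm k 2, pow_mul]; norm_num
    rw [div_pow, one_pow, h2]
    field_simp
  calc Real.exp 1 * Real.exp 1 ^ k * 2 ^ k * (k : ℝ) ^ 3 * (1 / 4 ^ k) ^ 2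
      = (Real.exp 1 * (k : ℝ) ^ 3) * (Real.exp 1 ^ k * ((1 / 4 ^ k) ^ 2 * 2 ^ k)) := by ring
    _ ≤ (1 / 2 * (8 / Real.exp 1) ^ k) * (Real.exp 1 ^ k * (1 / 8 ^ k)) := by
        rw [h1]; gcongr
    _ = 1 / 2 := by
        have := Real.exp_pos 1
        rw [div_pow]
        field_simp

/-- The `n ^ 2` copies of a padded formula on `n (m + 1)` variables have at most `n ^ 5` variables
in total, so amplification costs only a constant factor in `log n`. -/
theorem log_pow_mul_le {k n m : ℕ} (hn0 : 0 < n) {α : ℝ} (hα : α = m / n) (hα2 : α ≤ 2 ^ k)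
    (hn : 2 ^ k + 1 ≤ n) :
    Real.log ((n ^ 2 * (n * (m + 1)) : ℕ) : ℝ) ≤ 5 * Real.log n := by
  have hn0' : (0 : ℝ) < n := by exact_mod_cast hn0
  have hm1 : (m : ℝ) + 1 ≤ (n : ℝ) ^ 2 := by
    have h2 : (2 : ℝ) ^ k + 1 ≤ n := by exact_mod_cast hn
    have h3 : (1 : ℝ) ≤ n := by exact_mod_cast hn0
    calc (m : ℝ) + 1 = α * n + 1 := by rw [hα]; field_simp
      _ ≤ 2 ^ k * n + n := by gcongr
      _ = (2 ^ k + 1) * n := by ring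
      _ ≤ n * n := by gcongr
      _ = (n : ℝ) ^ 2 := by ring
  have h1 : (5 : ℝ) * Real.log n = Real.log ((n : ℝ) ^ 5) := by
    rw [Real.log_pow]; norm_num
  rw [h1]
  push_cast
  refine Real.log_le_log (by positivity) ?_
  calc (n : ℝ) ^ 2 * (n * (m + 1)) ≤ (n : ℝ) ^ 2 * (n * (n : ℝ) ^ 2) := by gcongr
    _ = (n : ℝ) ^ 5 := by ring

end Parameters

/-! ### Choice of constants and assembly. -/

theorem mainTheorem1 (γ : ℝ) (hγ : 0 < γ) (hconn : BoundedDegreeConnectivity γ)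
    (ζ : ℝ) (hζ : ζ ∈ Set.Ioo (0 : ℝ) 1) :
    ∃ c : ℝ, 0 < c ∧ ∃ C : ℝ, 0 < C ∧ ∃ k₀ : ℕ, ∀ k : ℕ, k₀ ≤ k →
      ∀ ε : ℝ, 0 < ε → ∃ N : ℕ, ∀ n : ℕ, N ≤ n → ∀ m : ℕ, ∀ α : ℝ, α = (m : ℝ) / (n : ℝ) →
        α ≤ c / (k : ℝ) ^ 3 * (2 : ℝ) ^ ((1 - ζ) * γ * (k : ℝ)) →
        1 ≤ α * (k : ℝ) ^ 6 * Real.log (n : ℝ) →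
          1 - ε ≤ uniformProb (Finset.univ : Finset (KCNF k n m)) fun Φ =>
            Φ.RandomPairConnected (C * (α * (k : ℝ) ^ 6 * Real.log (n : ℝ))) ε ∧
            Φ.HasGiantComponent (C * (α * (k : ℝ) ^ 6 * Real.log (n : ℝ))) ε := by
  obtain ⟨c', hc', C', hC', k₁, hconn⟩ := hconn
  have hg : 0 < ζ * γ := mul_pos hζ.1 hγ
  have hpow : (1 : ℝ) < 2 ^ (ζ * γ) := Real.one_lt_rpow (by norm_num) hg
  have he8 : 1 < 8 / Real.exp 1 := by
    rw [lt_div_iff₀ (Real.exp_pos 1)]; linarith [Real.exp_one_lt_d9]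
  obtain ⟨k₀, hk₀⟩ := Filter.eventually_atTop.1
    (((eventually_pow_le_mul_pow 8 hc' (show (0 : ℝ) < 160 by norm_num) hpow).and
      (eventually_pow_le_mul_pow 3 (show (0 : ℝ) < 1 / 2 by norm_num) (Real.exp_pos 1) he8)).and
      ((Filter.eventually_ge_atTop 10).and (Filter.eventually_ge_atTop k₁)))
  -- `200 = 8 * 5 * 5`: padding, `d ≤ 5 α k ^ 4`, and `5 log n` for the enlarged variable set. The
  -- extra `1` guarantees `D ≥ 1`, so that single flips are allowed.
  refine ⟨1, one_pos, 200 * C' + 1, by positivity, k₀, fun k hk ε hε => ?_⟩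
  obtain ⟨⟨hk8, hk3⟩, hk10, hkk₁⟩ := hk₀ k hk
  obtain ⟨N₁, hN₁⟩ := hconn k hkk₁ (1 / 2) (by norm_num)
  -- The hypothesis includes satisfiability, so `(c' / k ^ 3) 2 ^ (γ k) < 2 ^ k`. This yields `α ≤ 2
  -- ^ k` and the local lemma condition without an upper bound on `γ`.
  have hTlt := BoundedDegreeConnectivity.lt_two_pow
    (D := fun d n => C' * ((d : ℝ) * (k : ℝ) ^ 2 * Real.log (n : ℝ))) hN₁
  have hkr : (10 : ℝ) ≤ k := by exact_mod_cast hk10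
  have hk0 : (0 : ℝ) < k := by linarith
  have hkexp := exp_mul_pow_le_half hk3
  obtain ⟨N, hN⟩ := Filter.eventually_atTop.1
    ((((eventually_le_mul_natCast (4 * (Real.exp 1 * Real.exp 1 ^ k * (k : ℝ) ^ k)) hε).and
      (eventually_le_mul_natCast (12 * (Real.exp 1 * Real.exp 1 ^ k * 2 ^ k * (k : ℝ) ^ 3)) hε)).and
      ((eventually_le_mul_natCast (3 * 4 ^ k) hε).and (eventually_le_mul_natCast 9 hε))).and
      ((((Real.tendsto_log_atTop.comp tendsto_natCast_atTop_atTop).eventually_ge_atTop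
        (Real.exp 1 ^ 3 * 2 ^ k * k)).and (Filter.eventually_ge_atTop (4 ^ k))).and
        ((Filter.eventually_ge_atTop (2 ^ k + 1)).and (Filter.eventually_ge_atTop N₁))))
  refine ⟨N, fun n hn m α hα hαle hD => ?_⟩
  obtain ⟨⟨⟨hn1, hn2⟩, hn3, hn4⟩, ⟨hlog, hn5⟩, hn6, hn7⟩ := hN n hn
  have hkn : k ≤ n := (Nat.lt_pow_self (by norm_num)).le.trans hn5
  have hn0 : (0 : ℝ) < n := by exact_mod_cast (by omega : 0 < n)
  have hα0 : 0 ≤ α := by rw [hα]; positivity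
  have hD1 : 1 ≤ (200 * C' + 1) * (α * (k : ℝ) ^ 6 * Real.log n) := by nlinarith
  rcases le_or_gt (α * (k : ℝ) ^ 3) 1 with hsparse | hdense
  · exact connected_prob_of_sparse hk10 hkn hα hsparse hD1 hε hn1
  have hQ : (2 : ℝ) ^ (ζ * γ * k) = (2 ^ (ζ * γ)) ^ k := by
    rw [Real.rpow_mul (by norm_num), Real.rpow_natCast]
  rw [← hQ] at hk8
  have hPQ : (2 : ℝ) ^ ((1 - ζ) * γ * k) * 2 ^ (ζ * γ * k) = 2 ^ (γ * k) := by
    rw [← Real.rpow_add (by norm_num)]; congr 1; ring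
  set P : ℝ := 2 ^ ((1 - ζ) * γ * k) with hP
  set Q : ℝ := 2 ^ (ζ * γ * k) with hQ'
  have hP0 : 0 < P := by positivity
  rw [← hPQ] at hTlt
  have hαP : α * (k : ℝ) ^ 3 ≤ P := by
    rwa [div_mul_eq_mul_div, one_mul, le_div_iff₀ (by positivity)] at hαle
  -- The slack `Q = 2 ^ (ζ γ k)` absorbs all polynomial losses in `k`.
  have h160 : 160 * (α * (k : ℝ) ^ 8) ≤ c' / (k : ℝ) ^ 3 * (P * Q) := by
    rw [div_mul_eq_mul_div, le_div_iff₀ (by positivity)]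
    calc 160 * (α * (k : ℝ) ^ 8) * (k : ℝ) ^ 3
        = (160 * (k : ℝ) ^ 8) * (α * (k : ℝ) ^ 3) := by ring
      _ ≤ (c' * Q) * P := by gcongr
      _ = c' * (P * Q) := by ring
  have hkpow : ∀ a ≤ 8, α * (k : ℝ) ^ a ≤ α * (k : ℝ) ^ 8 := fun a ha => by
    gcongr
    linarith
  have hα4 : (k : ℝ) ≤ α * (k : ℝ) ^ 4 := by
    rw [pow_succ, ← mul_assoc]; nlinarith
  -- The power `k ^ 4` serves both lower bounds on `d`: `α k ^ 3 > 1` gives `d ≥ 4 k`, and `k ^ 3 ≥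
  -- e` gives `d ≥ 4 e α k`. With the `k ^ 2` of the hypothesis it makes the `k ^ 6` in `D`.
  obtain ⟨d, hd⟩ : ∃ d, d = ⌈4 * (α * (k : ℝ) ^ 4)⌉₊ := ⟨_, rfl⟩
  have hdle : 4 * (α * (k : ℝ) ^ 4) ≤ d := by rw [hd]; exact Nat.le_ceil _
  have hdge : (d : ℝ) ≤ 5 * (α * (k : ℝ) ^ 4) := by
    have : (d : ℝ) < 4 * (α * (k : ℝ) ^ 4) + 1 := by
      rw [hd]; exact Nat.ceil_lt_add_one (by positivity)
    linarith
  have hα2 : α ≤ 2 ^ k := by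
    have := hkpow 0 (by norm_num)
    rw [pow_zero, mul_one] at this
    have : 0 ≤ α * (k : ℝ) ^ 8 := by positivity
    linarith
  have hkd : 4 * (k * d) ≤ 2 ^ (k - 3) := by
    have h1 : 8 * (4 * (k * d) : ℝ) ≤ 2 ^ k := by
      calc 8 * (4 * (k * d) : ℝ) ≤ 8 * (4 * (k * (5 * (α * (k : ℝ) ^ 4)))) := by gcongr
        _ = 160 * (α * (k : ℝ) ^ 5) := by ring
        _ ≤ 160 * (α * (k : ℝ) ^ 8) := by linarith [hkpow 5 (by norm_num)]
        _ ≤ 2 ^ k := h160.trans hTlt.le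
    have h2 : 8 * (4 * (k * d)) ≤ 2 ^ k := by exact_mod_cast h1
    have h3 : 2 ^ k = 8 * 2 ^ (k - 3) := by
      rw [show (8 : ℕ) = 2 ^ 3 by norm_num, ← pow_add]; congr 1; omega
    omega
  refine connected_prob_of_dense hk10 hkn hα hα2 (d := d) ?_ ?_ hkd hkexp hD1 hn5 hn2 hn3 hn4
    hlog ?_
  · have : (4 * k : ℝ) ≤ d := by linarith
    exact_mod_cast this
  · have h1 : Real.exp 1 ≤ (k : ℝ) ^ 3 := by
      have : (k : ℝ) ≤ (k : ℝ) ^ 3 := le_self_pow₀ (by linarith) (by norm_num)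
      linarith [Real.exp_one_lt_d9]
    calc 4 * Real.exp 1 * α * k ≤ 4 * (k : ℝ) ^ 3 * α * k := by gcongr
      _ = 4 * (α * (k : ℝ) ^ 4) := by ring
      _ ≤ d := hdle
  · intro m' Ψ hΨ
    have hnn : n ≤ n ^ 2 * (n * (m + 1)) := by
      rw [mul_left_comm]
      exact Nat.le_mul_of_pos_right _ (Nat.mul_pos (Nat.pow_pos (by omega)) (Nat.succ_pos m))
    have hd1 : 1 ≤ 8 * d := by
      have : (0 : ℝ) < d := by linarith
      have : 0 < d := by exact_mod_cast this
      omega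
    refine (hN₁ _ (hn7.trans hnn) (8 * d) hd1 ?_ m' Ψ hΨ).mono ?_
    · push_cast
      rw [← hPQ]
      refine le_trans ?_ h160
      linarith [hkpow 4 (by norm_num)]
    · have hlog5 := log_pow_mul_le (by omega) hα hα2 hn6
      have hlog0 : 0 ≤ Real.log n := Real.log_natCast_nonneg n
      have hlog1 := Real.log_natCast_nonneg (n ^ 2 * (n * (m + 1)))
      push_cast at hlog5 hlog1 ⊢
      calc C' * (8 * (d : ℝ) * (k : ℝ) ^ 2 * Real.log ((n : ℝ) ^ 2 * (n * (m + 1))))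
          ≤ C' * (8 * (5 * (α * (k : ℝ) ^ 4)) * (k : ℝ) ^ 2 * (5 * Real.log n)) := by gcongr
        _ = 200 * C' * (α * (k : ℝ) ^ 6 * Real.log n) := by ring
        _ ≤ (200 * C' + 1) * (α * (k : ℝ) ^ 6 * Real.log n) := by
          gcongr
          linarith
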